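/- Let $\lambda>0$ be known and let $f$ be a probability density on $\mathbb R$. Let $X_1,X_2,\dots$ be independent copies of the Poisson sum $X=\sum_{j=1}^{N}Y_j$, where $N$ is Poisson with parameter $\lambda$ and $Y_1,Y_2,\dots$ are i.i.d. with density $f$ and independent of $N$. Let $Z_1,Z_2,\dots$ be the successive nonzero values among $X_1,X_2,\dots$. For an integrable function $u$ write $\phi_u(t)=\int e^{itx}u(x)\,dx$. Let $\beta,L_1,L_2>0$, let $l=\lfloor\beta\rfloor$ be the integer part of $\beta$, and assume the following. **(F)** The derivatives of $f$ up to order $l$ exist, and for all $x,t\in\mathbb R$ $$|f^{(l)}(x+t)-f^{(l)}(x)|\le L_1|t|^{\beta-l},\qquad \Big[\int_{-\infty}^{\infty} \big(f^{(l)}(y+t)-f^{(l)}(y)\big)^2dy\Big]^{1/2}\le L_2|t|^{\beta-l};$$ moreover $|t|^\beta\phi_f(t)$ is integrable and $f',\dots,f^{(l)}$ are integrable. **(W)** $w:\mathbb R\to\mathbb R$ is bounded and symmetric, $u^jw(u)$ is integrable for $j=0,\dots,l$, $\int w(u)\,du=1$, and $\int u^jw(u)\,du=0$ for all integers $j$ with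 $1\le j<\beta$; $\phi_w$ vanishes outside $[-1,1]$ and is continuously differentiable; $\int|u|^\beta|w(u)|\,du<\infty$; and $\lim_{|u|\to\infty}|u\,w(u)|=0$. **(H)** $h=h_n=Cn^{-\gamma}$ for some constants $C>0$ and $0<\gamma<1$. **(M)** $M_n=n^{\alpha}$ for some constant $\alpha>0$. Put $\phi_{\rm emp}(t)=\frac1n\sum_{j=1}^n e^{itZ_j}$ and $\psi_{nh}(t)=(e^\lambda-1)\phi_{\rm emp}(t)\phi_w(ht)+1$. If $\psi_{nh}$ has no zero on $\mathbb R$, let $$f_{nh}(x)=\frac1{2\pi\lambda}\int_{-1/h}^{1/h}e^{-itx}\,\mathrm{Log}(\psi_{nh})(t)\,dt ,$$ where $\mathrm{Log}(\psi_{nh})$ is the distinguished logarithm, that is, the unique continuous function $L:\mathbb R\to\mathbb C$ with $e^{L}=\psi_{nh}$ and $L(0)=\lambda$ (note that $\psi_{nh}(0)=e^\lambda$); otherwise let $f_{nh}(x)=0$. Let $\hat f_{nh}(x)=(M_n\wedge f_{nh}(x))\vee(-M_n)$. **Proposition 2.1.** For every $x\in\mathbb R$ and $n\ge1$ the random variable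 $\hat f_{nh}(x)$ is integrable, and as $n\to\infty$ $$\mathbb E[\hat f_{nh}(x)]-f(x)=O\Big(h^\beta+\frac1{nh}\Big).$$ -/

import Mathlib

open MeasureTheory ProbabilityTheory Filter Topology Asymptotics
open scoped NNReal ENNReal

noncomputable section

namespace Decompounding

/-- The characteristic function `t ↦ ∫ e^{itx} u(x) dx` of a (signed) density `u`. -/
def cf (u : ℝ → ℝ) (t : ℝ) : ℂ :=
  ∫ x : ℝ, Complex.exp (Complex.I * (t : ℂ) * (x : ℂ)) * ((u x : ℝ) : ℂ)

/-- `f` is a probability density on the real line. -/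
structure IsDensity (f : ℝ → ℝ) : Prop where
  nonneg : ∀ x, 0 ≤ f x
  integrable : Integrable f
  integral_eq_one : ∫ x, f x = 1

/-- The derivatives of `f` up to order `l` exist everywhere. -/
def HasDerivsUpTo (l : ℕ) (f : ℝ → ℝ) : Prop :=
  ∀ j < l, Differentiable ℝ (iteratedDeriv j f)

/-- The Hölder class `H(β, L)`; here `l = ⌊β⌋` is the integer part of `β`. -/
def HolderClass (β L : ℝ) (f : ℝ → ℝ) : Prop :=
  HasDerivsUpTo ⌊β⌋₊ f ∧
    ∀ x t : ℝ, |iteratedDeriv ⌊β⌋₊ f (x + t) - iteratedDeriv ⌊β⌋₊ f x|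
      ≤ L * |t| ^ (β - (⌊β⌋₊ : ℝ))

/-- The Nikol'ski class `N(β, L)`: the `L²` distance (with values in `[0, ∞]`) between `f^(l)` and
its translate by `t` is at most `L |t|^(β - l)`. -/
def NikolskiClass (β L : ℝ) (f : ℝ → ℝ) : Prop :=
  HasDerivsUpTo ⌊β⌋₊ f ∧
    ∀ t : ℝ, eLpNorm (fun x : ℝ => iteratedDeriv ⌊β⌋₊ f (x + t) - iteratedDeriv ⌊β⌋₊ f x) 2 volume
      ≤ ENNReal.ofReal (L * |t| ^ (β - (⌊β⌋₊ : ℝ)))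

/-- Condition F on the density `f`. -/
structure ConditionF (β L₁ L₂ : ℝ) (f : ℝ → ℝ) : Prop where
  density : IsDensity f
  holder : HolderClass β L₁ f
  nikolski : NikolskiClass β L₂ f
  integrable_cf : Integrable (fun t : ℝ => ((|t| ^ β : ℝ) : ℂ) * cf f t)
  integrable_deriv : ∀ j : ℕ, 1 ≤ j → j ≤ ⌊β⌋₊ → Integrable (iteratedDeriv j f)

/-- Condition W on the kernel `w`. The moments of `w` of all integer orders `1 ≤ j < β` vanish:
these are the orders `1, …, ⌊β⌋ - 1` if `β` is an integer, and `1, …, ⌊β⌋` otherwise. -/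
structure ConditionW (β : ℝ) (w : ℝ → ℝ) : Prop where
  bounded : ∃ B : ℝ, ∀ u, |w u| ≤ B
  symmetric : ∀ u, w (-u) = w u
  integrable_moment : ∀ j : ℕ, j ≤ ⌊β⌋₊ → Integrable (fun u : ℝ => u ^ j * w u)
  integral_eq_one : ∫ u, w u = 1
  moment_eq_zero : ∀ j : ℕ, 1 ≤ j → (j : ℝ) < β → ∫ u : ℝ, u ^ j * w u = 0
  cf_support : ∀ t : ℝ, 1 < |t| → cf w t = 0
  integrable_abs_moment : Integrable (fun u : ℝ => |u| ^ β * |w u|)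
  tendsto_zero : Tendsto (fun u : ℝ => |u * w u|) (cocompact ℝ) (𝓝 0)
  cf_contDiff : ContDiff ℝ 1 (cf w)

/-- Condition H on the bandwidths. -/
def ConditionH (h : ℕ → ℝ) : Prop :=
  ∃ C γ : ℝ, 0 < C ∧ 0 < γ ∧ γ < 1 ∧ ∀ n : ℕ, 1 ≤ n → h n = C * (n : ℝ) ^ (-γ)

/-- Condition M on the truncating sequence. -/
def ConditionM (M : ℕ → ℝ) : Prop :=
  ∃ α : ℝ, 0 < α ∧ ∀ n : ℕ, 1 ≤ n → M n = (n : ℝ) ^ α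

/-- The law of the Poisson sum `Y_1 + ⋯ + Y_N`, where `N` is Poisson with parameter `lam`,
the `Y_j` are independent with common law `μ`, and `N` is independent of the sequence `(Y_j)`. -/
def compoundPoissonLaw (lam : ℝ≥0) (μ : Measure ℝ) : Measure ℝ :=
  ((poissonMeasure lam).prod (Measure.infinitePi (fun _ : ℕ => μ))).map
    (fun p : ℕ × (ℕ → ℝ) => ∑ j ∈ Finset.range p.1, p.2 j)

/-- `X 0, X 1, …` are independent observations of the Poisson sum with intensity `lam` whose
summands have density `f`. -/
structure IsSample {Ω : Type*} [MeasurableSpace Ω] (P : Measure Ω) (lam : ℝ≥0) (f : ℝ → ℝ)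
    (X : ℕ → Ω → ℝ) : Prop where
  measurable : ∀ i, Measurable (X i)
  indep : iIndepFun X P
  law : ∀ i, P.map (X i)
    = compoundPoissonLaw lam (volume.withDensity (fun x => ENNReal.ofReal (f x)))

/-- `nonzeroObs X k` is the nonzero observation number `k` (counted from `0`) in the sequence
`X 0, X 1, …`; almost surely there are infinitely many of them. -/
def nonzeroObs {Ω : Type*} (X : ℕ → Ω → ℝ) (k : ℕ) (ω : Ω) : ℝ :=
  X (Nat.nth (fun i => X i ω ≠ 0) k) ω

/-- The empirical characteristic function of `z 0, …, z (n - 1)`. -/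
def empCf (n : ℕ) (z : ℕ → ℝ) (t : ℝ) : ℂ :=
  (1 / (n : ℂ)) * ∑ j ∈ Finset.range n, Complex.exp (Complex.I * (t : ℂ) * ((z j : ℝ) : ℂ))

open Classical in
/-- The distinguished logarithm of a path `ψ : ℝ → ℂ`: the continuous `L` with `exp ∘ L = ψ` whose
value at `0` is the principal logarithm of `ψ 0`. For a continuous path without zeros it exists, and
it is unique; if there is no such `L` the value is `0`. -/
def distLog (ψ : ℝ → ℂ) : ℝ → ℂ :=
  if H : ∃ L : ℝ → ℂ, Continuous L ∧ L 0 = Complex.log (ψ 0) ∧ ∀ t, Complex.exp (L t) = ψ t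
  then H.choose else 0

/-- The path `t ↦ (e^lam - 1) φ_emp(t) φ_w(ht) + 1`. -/
def path (lam : ℝ≥0) (w : ℝ → ℝ) (h : ℝ) (n : ℕ) (z : ℕ → ℝ) (t : ℝ) : ℂ :=
  ((Real.exp lam - 1 : ℝ) : ℂ) * (empCf n z t * cf w (h * t)) + 1

open Classical in
/-- The estimator `f_{nh}(x)` before truncation. The integral is real for symmetric `w`, so that
taking the real part only changes its type. -/
def rawEstimator (lam : ℝ≥0) (w : ℝ → ℝ) (h : ℝ) (n : ℕ) (z : ℕ → ℝ) (x : ℝ) : ℝ :=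
  if ∀ t : ℝ, path lam w h n z t ≠ 0 then
    (1 / (2 * Real.pi * (lam : ℝ))) *
      (∫ t in (-(1 / h))..(1 / h),
        Complex.exp (-(Complex.I * (t : ℂ) * (x : ℂ))) * distLog (path lam w h n z) t).re
  else 0

/-- The truncated estimator `(M ∧ f_{nh}(x)) ∨ (-M)`. -/
def estimator (lam : ℝ≥0) (w : ℝ → ℝ) (h M : ℝ) (n : ℕ) (z : ℕ → ℝ) (x : ℝ) : ℝ :=
  max (min M (rawEstimator lam w h n z x)) (-M)

end Decompounding

end

/-!
# The bias of the kernel decompounding estimator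

Write `φ = cf f`, let `g` be the law of the nonzero observations and `T = 1 / h`. The nonzero terms
of an i.i.d. sequence are i.i.d. with the law conditioned on being nonzero
(`nonzeroObs_iid`), and since the Poisson sum vanishes exactly when `N = 0`, up to a null set,
`(e^λ - 1) φ_g + 1 = e^{λφ}` (`IsDensity.charFun_nonzeroLaw`). Hence the path `ψ` of the
estimator has the relative error `q = ψ / e^{λφ} - 1 = s (φ_emp - φ_g) + d`, with bounded
`s = e^{-λφ} (e^λ - 1) φ_w(h ·)` and deterministic `d = (1 - e^{-λφ}) (φ_w(h ·) - 1)`.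

The event on which `φ_emp` is uniformly close to `φ_g` on `[-T, T]` has exponentially small
complement: Hoeffding's inequality on a grid suffices, and no moment of `f` is needed
(`IsIID.exists_uniform_deviation`). On it `|q| ≤ 1/2` on the whole line, so that the
distinguished logarithm of `ψ` is `λφ + log (1 + q)`, and `|log (1 + q) - q| ≤ |q|²`
(`exists_expansion`). Integrating against `e^{-itx} / (2πλ)` over `[-T, T]` yields four terms.
* `λφ` reproduces `f x` by Fourier inversion, up to the tail over `|t| > T`, which is at most
  `h ^ β ∫ |t|^β |φ|`.
* `d` contributes `O(h ^ β)`, because the vanishing moments of `w` give `|φ_w(s) - 1| ≤ C |s|^β`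
  (`ConditionW.exists_norm_cf_sub_one_le`), while `|1 - e^{-λφ}| ≤ C |φ|`.
* `s (φ_emp - φ_g)` gives a centred average of `n` i.i.d. terms (`linearTerm`). Its variance is
  `O(1 / (n h))`, as the second moment of one term is a double integral of `φ_g(t - u)` over
  `[-T, T]²` and `φ_g` is integrable.
* `|q|²` contributes `∫ |φ_emp - φ_g|²` over `[-T, T]`, whose mean is at most `2 T / n`, and another
  `O(h ^ β)`.

The centred term disappears on taking expectations over the whole space. Truncation at `M` costs at
most the square of that term once `M ≥ |f x| + 1` (`abs_trunc_sub_le`), and on the exceptional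
event everything is bounded by powers of `n`, which the exponentially small probability absorbs.
The estimator is a measurable function of the sample because it is continuous on the open set of
samples whose path has a distinguished logarithm, and zero elsewhere (`measurable_rawEstimator`).
-/

namespace Decompounding

/-! ### The subsequence of nonzero observations -/

/-- The subsequence of the nonzero terms of a real sequence. -/
noncomputable def nonzeroSubseq (x : ℕ → ℝ) (k : ℕ) : ℝ :=
  x (Nat.nth (fun i => x i ≠ 0) k)

/-- The sequence obtained by putting a term in front of a sequence. -/
def consSeq (p : ℝ × (ℕ → ℝ)) (n : ℕ) : ℝ :=
  Nat.casesOn n p.1 p.2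

lemma measurable_consSeq : Measurable consSeq := by
  refine measurable_pi_lambda _ fun n => ?_
  cases n with
  | zero => exact measurable_fst
  | succ n => exact (measurable_pi_apply n).comp measurable_snd

/-- A product measure on sequences is the law of an independent first term followed by a sequence
with the same product law. -/
lemma map_consSeq_prod (ν : Measure ℝ) [IsProbabilityMeasure ν] :
    (ν.prod (Measure.infinitePi fun _ : ℕ => ν)).map consSeq
      = Measure.infinitePi fun _ : ℕ => ν := by
  refine Measure.eq_infinitePi _ fun s t ht => ?_
  rw [Measure.map_apply measurable_consSeq
    (MeasurableSet.pi s.countable_toSet fun i _ => ht i)]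
  -- Enlarge the box to the coordinates `0, …, N`, with the trivial constraint off `s`.
  classical
  obtain ⟨N, hN⟩ := s.exists_nat_subset_range
  set t' : ℕ → Set ℝ := fun i => if i ∈ s then t i else Set.univ with ht'
  have ht'm : ∀ i, MeasurableSet (t' i) := by
    intro i; simp only [ht']; split_ifs
    · exact ht i
    · exact .univ
  have hpre : consSeq ⁻¹' (Set.pi s t)
      = (t' 0) ×ˢ (Set.pi (Finset.range N : Set ℕ) fun i => t' (i + 1)) := by
    ext p
    simp only [Set.mem_preimage, Set.mem_pi, Finset.mem_coe, Set.mem_prod, Finset.mem_range, ht']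
    constructor
    · intro H
      refine ⟨?_, fun i _ => ?_⟩
      · split_ifs with h0
        · exact H 0 h0
        · trivial
      · split_ifs with h0
        · exact H (i + 1) h0
        · trivial
    · rintro ⟨H0, H1⟩ i hi
      cases i with
      | zero =>
        rw [if_pos hi] at H0
        exact H0
      | succ i =>
        have h2 := Finset.mem_range.1 (hN hi)
        have := H1 i (by omega)
        rw [if_pos hi] at this
        exact this
  rw [hpre, Measure.prod_prod, Measure.infinitePi_pi _ (fun i _ => ht'm (i + 1))]
  have h3 : ν (t' 0) * ∏ i ∈ Finset.range N, ν (t' (i + 1))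
      = ∏ i ∈ Finset.range (N + 1), ν (t' i) := by
    rw [Finset.prod_range_succ']; ring
  rw [h3]
  have h4 : s ⊆ Finset.range (N + 1) := hN.trans (Finset.range_mono (Nat.le_succ N))
  rw [← Finset.prod_subset h4]
  · exact Finset.prod_congr rfl fun i hi => by simp [ht', hi]
  · intro i _ hi; simp [ht', hi]

lemma nth_succ_of_not {p : ℕ → Prop} (hp : (Set.ofPred p).Infinite) (h0 : ¬ p 0) (k : ℕ) :
    Nat.nth p k = Nat.nth (fun i => p (i + 1)) k + 1 := by
  refine (Nat.nth_add_one h0 fun h => h0 ?_).symm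
  have := Nat.nth_mem_of_infinite hp k
  rwa [h] at this

lemma infinite_shift {p : ℕ → Prop} (hp : (Set.ofPred p).Infinite) :
    (Set.ofPred fun i => p (i + 1)).Infinite := by
  rw [← Nat.frequently_atTop_iff_infinite] at hp ⊢
  rw [frequently_atTop] at hp ⊢
  intro a
  obtain ⟨b, hb, h⟩ := hp (a + 1)
  exact ⟨b - 1, by omega, by rwa [Nat.sub_add_cancel (by omega)]⟩

lemma nth_succ_of_pos {p : ℕ → Prop} (hp : (Set.ofPred p).Infinite) (h0 : p 0) (k : ℕ) :
    Nat.nth p (k + 1) = Nat.nth (fun i => p (i + 1)) k + 1 := by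
  classical
  have hq := infinite_shift hp
  have hmem := Nat.nth_mem_of_infinite hq k
  have hc : Nat.count p (Nat.nth (fun i => p (i + 1)) k + 1) = k + 1 := by
    rw [Nat.count_succ', Nat.count_nth_of_infinite hq, if_pos h0]
  have h2 : p (Nat.nth (fun i => p (i + 1)) k + 1) := hmem
  rw [← Nat.nth_count h2, hc]

lemma infinite_of_shift {p : ℕ → Prop} (hp : (Set.ofPred fun i => p (i + 1)).Infinite) :
    (Set.ofPred p).Infinite := by
  rw [← Nat.frequently_atTop_iff_infinite] at hp ⊢
  rw [frequently_atTop] at hp ⊢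
  intro a
  obtain ⟨b, hb, h⟩ := hp a
  exact ⟨b + 1, by omega, h⟩

lemma measurableSet_nth_eq (k i : ℕ) :
    MeasurableSet {x : ℕ → ℝ | Nat.nth (fun i => x i ≠ 0) k = i} := by
  classical
  have hcount : ∀ j k : ℕ, MeasurableSet {x : ℕ → ℝ | Nat.count (fun i => x i ≠ 0) j = k} := by
    intro j
    induction j with
    | zero => intro k; simp
    | succ j ih =>
      intro k
      have hz : MeasurableSet {x : ℕ → ℝ | x j ≠ 0} :=
        measurableSet_eq_fun (measurable_pi_apply j) measurable_const |>.compl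
      have : {x : ℕ → ℝ | Nat.count (fun i => x i ≠ 0) (j + 1) = k}
          = ({x | x j ≠ 0} ∩ ⋃ l ∈ {l : ℕ | l + 1 = k}, {x | Nat.count (fun i => x i ≠ 0) j = l})
            ∪ ({x | x j ≠ 0}ᶜ ∩ {x | Nat.count (fun i => x i ≠ 0) j = k}) := by
        ext x
        simp only [Nat.count_succ, Set.mem_ofPred_eq, Set.mem_union, Set.mem_inter_iff,
          Set.mem_iUnion, Set.mem_compl_iff, exists_prop]
        by_cases hx : x j = 0
        · simp [hx]
        · simp [hx]
      rw [this]
      refine (hz.inter ?_).union (hz.compl.inter (ih k))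
      exact MeasurableSet.biUnion (Set.to_countable _) fun l _ => ih l
  have hm : ∀ j, MeasurableSet {x : ℕ → ℝ | x j ≠ 0 ∧ Nat.count (fun i => x i ≠ 0) j = k} :=
    fun j => (measurableSet_eq_fun (measurable_pi_apply j) measurable_const).compl.inter
      (hcount j k)
  -- If the sequence has fewer than `k + 1` nonzero terms, then `Nat.nth` takes the value `0`.
  have : {x : ℕ → ℝ | Nat.nth (fun i => x i ≠ 0) k = i}
      = {x | x i ≠ 0 ∧ Nat.count (fun i => x i ≠ 0) i = k}
        ∪ {x | i = 0 ∧ x ∉ ⋃ j, {x : ℕ → ℝ | x j ≠ 0 ∧ Nat.count (fun i => x i ≠ 0) j = k}} := by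
    ext x
    simp only [Set.mem_ofPred_eq, Set.mem_union, Set.mem_iUnion, not_exists]
    by_cases hx : ∃ j, x j ≠ 0 ∧ Nat.count (fun i => x i ≠ 0) j = k
    · obtain ⟨j, hj, hjk⟩ := hx
      have h1 : Nat.nth (fun i => x i ≠ 0) k = j := by
        rw [← hjk]; exact Nat.nth_count (p := fun i => x i ≠ 0) hj
      rw [h1]
      constructor
      · rintro rfl; exact Or.inl ⟨hj, hjk⟩
      · rintro (⟨h2, h3⟩ | ⟨_, h3⟩)
        · rw [← h1, ← h3]; exact Nat.nth_count (p := fun i => x i ≠ 0) h2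
        · exact absurd ⟨hj, hjk⟩ (h3 j)
    · have h1 : Nat.nth (fun i => x i ≠ 0) k = 0 := by
        rw [Nat.nth_eq_zero]
        right
        by_contra! hcon
        exact hx ⟨_, Nat.nth_mem k hcon, Nat.count_nth hcon⟩
      push Not at hx
      constructor
      · intro h2; right
        exact ⟨by omega, fun j hj => hx j hj.1 hj.2⟩
      · rintro (⟨h2, h3⟩ | ⟨h2, _⟩)
        · exact absurd h3 (hx i h2)
        · omega
  rw [this]
  refine (hm i).union ?_
  by_cases hi : i = 0
  · simp only [hi, true_and]
    exact (MeasurableSet.iUnion hm).compl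
  · simp [hi]

lemma measurable_nonzeroSubseq : Measurable nonzeroSubseq := by
  refine measurable_pi_lambda _ fun k => ?_
  have h1 : Measurable fun x : ℕ → ℝ => Nat.nth (fun i => x i ≠ 0) k :=
    measurable_to_countable' fun i => measurableSet_nth_eq k i
  have h2 : Measurable fun q : (ℕ → ℝ) × ℕ => q.1 q.2 :=
    measurable_from_prod_countable_left fun i => measurable_pi_apply i
  exact h2.comp (measurable_id.prodMk h1)

lemma nonzeroSubseq_consSeq_zero {x : ℕ → ℝ} (hx : (Set.ofPred fun i => x i ≠ 0).Infinite) (k : ℕ) :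
    nonzeroSubseq (consSeq (0, x)) k = nonzeroSubseq x k := by
  have hinf : (Set.ofPred fun i => consSeq (0, x) i ≠ 0).Infinite := infinite_of_shift hx
  unfold nonzeroSubseq
  rw [nth_succ_of_not hinf (by simp [consSeq])]
  rfl

lemma nonzeroSubseq_consSeq_of_ne {a : ℝ} (ha : a ≠ 0) {x : ℕ → ℝ}
    (hx : (Set.ofPred fun i => x i ≠ 0).Infinite) (k : ℕ) :
    nonzeroSubseq (consSeq (a, x)) k = consSeq (a, nonzeroSubseq x) k := by
  have hinf : (Set.ofPred fun i => consSeq (a, x) i ≠ 0).Infinite := infinite_of_shift hx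
  have h0 : consSeq (a, x) 0 ≠ 0 := ha
  cases k with
  | zero =>
    unfold nonzeroSubseq
    rw [Nat.nth_zero_of_zero (p := fun i => consSeq (a, x) i ≠ 0) h0]
    rfl
  | succ k =>
    unfold nonzeroSubseq
    rw [nth_succ_of_pos hinf h0]
    rfl

lemma ae_infinite_ne_zero (ν : Measure ℝ) [IsProbabilityMeasure ν] (hν : ν {0} < 1) :
    ∀ᵐ x ∂(Measure.infinitePi fun _ : ℕ => ν), (Set.ofPred fun i => x i ≠ 0).Infinite := by
  have key : ∀ m : ℕ, ∀ᵐ x ∂(Measure.infinitePi fun _ : ℕ => ν), ∃ i ≥ m, x i ≠ 0 := by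
    intro m
    rw [ae_iff]
    have hle : ∀ k : ℕ, (Measure.infinitePi fun _ : ℕ => ν) {x | ¬ ∃ i ≥ m, x i ≠ 0}
        ≤ ν {0} ^ k := by
      intro k
      calc (Measure.infinitePi fun _ : ℕ => ν) {x | ¬ ∃ i ≥ m, x i ≠ 0}
          ≤ (Measure.infinitePi fun _ : ℕ => ν)
              (Set.pi (Finset.Ico m (m + k) : Set ℕ) fun _ => {0}) := by
            refine measure_mono fun x hx => ?_
            simp only [Set.mem_ofPred_eq] at hx
            push Not at hx
            intro i hi
            exact hx i (Finset.mem_Ico.1 hi).1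
        _ = ν {0} ^ k := by
            rw [Measure.infinitePi_pi _ (fun _ _ => measurableSet_singleton _)]
            simp
    have hlim := ENNReal.tendsto_pow_atTop_nhds_zero_of_lt_one hν
    exact le_antisymm (ge_of_tendsto' hlim hle) (zero_le)
  filter_upwards [ae_all_iff.2 key] with x hx
  rw [← Nat.frequently_atTop_iff_infinite]
  exact frequently_atTop.2 hx

lemma isProbabilityMeasure_cond_ne_zero (ν : Measure ℝ) [IsProbabilityMeasure ν]
    (hν : ν {0} < 1) : IsProbabilityMeasure (ν[|{0}ᶜ]) :=
  cond_isProbabilityMeasure fun h =>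
    hν.ne ((prob_compl_eq_zero_iff (measurableSet_singleton (0 : ℝ))).1 h)

/-- Conditioning on the first term `a` of the sequence, the probability `m (n + 1)` that the nonzero
terms number `0, …, n` lie in `B 0, …, B n` satisfies
`m (n + 1) = ν {0} * m (n + 1) + ν (B 0 \ {0}) * m' n`, where `m' n` is the same probability for the
sets `B 1, …, B n`. -/
lemma infinitePi_nonzeroSubseq_mem (ν : Measure ℝ) [IsProbabilityMeasure ν] (hν : ν {0} < 1)
    (n : ℕ) (B : ℕ → Set ℝ) (hB : ∀ k, MeasurableSet (B k)) :
    (Measure.infinitePi fun _ : ℕ => ν) {x | ∀ k < n, nonzeroSubseq x k ∈ B k}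
      = ∏ k ∈ Finset.range n, (ν[|{0}ᶜ]) (B k) := by
  set μ := Measure.infinitePi fun _ : ℕ => ν with hμ
  induction n generalizing B with
  | zero => simp
  | succ n ih =>
    have hms : ∀ (n : ℕ) (B : ℕ → Set ℝ), (∀ k, MeasurableSet (B k)) →
        MeasurableSet {x : ℕ → ℝ | ∀ k < n, nonzeroSubseq x k ∈ B k} := by
      intro n B hB
      have : {x : ℕ → ℝ | ∀ k < n, nonzeroSubseq x k ∈ B k}
          = ⋂ k ∈ {k : ℕ | k < n}, {x | nonzeroSubseq x k ∈ B k} := by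
        ext x; simp
      rw [this]
      exact MeasurableSet.biInter (Set.to_countable _) fun k _ =>
        (measurable_pi_apply k).comp measurable_nonzeroSubseq (hB k)
    set S := {x : ℕ → ℝ | ∀ k < n + 1, nonzeroSubseq x k ∈ B k} with hS
    set S' := {x : ℕ → ℝ | ∀ k < n, nonzeroSubseq x k ∈ B (k + 1)} with hS'
    have hrec : μ S = ν {0} * μ S + ν ({0}ᶜ ∩ B 0) * μ S' := by
      calc μ S = (ν.prod μ) (consSeq ⁻¹' S) := by
            conv_lhs => rw [hμ, ← map_consSeq_prod ν]
            rw [Measure.map_apply measurable_consSeq (hms _ _ hB)]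
        _ = (ν.prod μ) (({0} ×ˢ S) ∪ (({0}ᶜ ∩ B 0) ×ˢ S')) := by
            refine measure_congr ?_
            have hae : ∀ᵐ p ∂(ν.prod μ), (Set.ofPred fun i => p.2 i ≠ 0).Infinite :=
              Measure.quasiMeasurePreserving_snd.ae (ae_infinite_ne_zero ν hν)
            filter_upwards [hae] with p hp
            obtain ⟨a, x⟩ := p
            refine propext ?_
            change consSeq (a, x) ∈ S ↔ (a, x) ∈ ({0} ×ˢ S) ∪ (({0}ᶜ ∩ B 0) ×ˢ S')
            simp only [Set.mem_union, Set.mem_prod, Set.mem_singleton_iff, Set.mem_inter_iff,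
              Set.mem_compl_iff]
            by_cases ha : a = 0
            · subst ha
              simp only [hS, Set.mem_ofPred_eq, nonzeroSubseq_consSeq_zero hp]
              simp
            · simp only [hS, hS', Set.mem_ofPred_eq, nonzeroSubseq_consSeq_of_ne ha hp, ha,
                false_and, false_or, not_false_eq_true, true_and]
              constructor
              · intro H
                exact ⟨H 0 (by omega), fun k hk => H (k + 1) (by omega)⟩
              · rintro ⟨H0, H⟩ k hk
                cases k with
                | zero => exact H0
                | succ k => exact H k (by omega)
        _ = ν {0} * μ S + ν ({0}ᶜ ∩ B 0) * μ S' := by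
            rw [measure_union, Measure.prod_prod, Measure.prod_prod]
            · rw [Set.disjoint_prod]
              left
              exact (disjoint_compl_right (a := ({0} : Set ℝ))).mono_right Set.inter_subset_left
            · exact ((measurableSet_singleton _).compl.inter (hB 0)).prod
                (hms n _ fun k => hB (k + 1))
    have hone : ν {0} + ν {0}ᶜ = 1 := by
      rw [measure_add_measure_compl (measurableSet_singleton _), measure_univ]
    have h0 : ν {0}ᶜ ≠ 0 := by
      intro h; rw [h, add_zero] at hone; exact hν.ne hone
    have hmul : ν {0}ᶜ * μ S = ν ({0}ᶜ ∩ B 0) * μ S' := by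
      have h1 : ν {0} * μ S + ν {0}ᶜ * μ S = ν {0} * μ S + ν ({0}ᶜ ∩ B 0) * μ S' := by
        rw [← add_mul, hone, one_mul]; exact hrec
      exact (ENNReal.add_right_inj (ENNReal.mul_ne_top (measure_ne_top _ _)
        (measure_ne_top _ _))).1 h1
    have hS'eq : μ S' = ∏ k ∈ Finset.range n, (ν[|{0}ᶜ]) (B (k + 1)) :=
      ih (fun k => B (k + 1)) fun k => hB (k + 1)
    rw [Finset.prod_range_succ', ← hS'eq, cond_apply (measurableSet_singleton _).compl, mul_comm,
      mul_assoc, ← hmul, ← mul_assoc, ENNReal.inv_mul_cancel h0 (measure_ne_top _ _),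
      one_mul]

/-- The nonzero terms of an i.i.d. sequence are i.i.d., with the conditional law given that a term
is nonzero. -/
lemma map_nonzeroSubseq_infinitePi (ν : Measure ℝ) [IsProbabilityMeasure ν] (hν : ν {0} < 1) :
    (Measure.infinitePi fun _ : ℕ => ν).map nonzeroSubseq
      = Measure.infinitePi fun _ : ℕ => ν[|{0}ᶜ] := by
  have := isProbabilityMeasure_cond_ne_zero ν hν
  refine Measure.eq_infinitePi _ fun s t ht => ?_
  rw [Measure.map_apply measurable_nonzeroSubseq
    (MeasurableSet.pi s.countable_toSet fun i _ => ht i)]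
  classical
  obtain ⟨N, hN⟩ := s.exists_nat_subset_range
  set t' : ℕ → Set ℝ := fun i => if i ∈ s then t i else Set.univ with ht'
  have ht'm : ∀ i, MeasurableSet (t' i) := by
    intro i; simp only [ht']; split_ifs
    · exact ht i
    · exact .univ
  have hset : nonzeroSubseq ⁻¹' (Set.pi s t) = {x | ∀ k < N, nonzeroSubseq x k ∈ t' k} := by
    ext x
    simp only [Set.mem_preimage, Set.mem_pi, Finset.mem_coe, Set.mem_ofPred_eq, ht']
    constructor
    · intro H k _
      split_ifs with h
      · exact H k h
      · trivial
    · intro H k hk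
      have := H k (Finset.mem_range.1 (hN hk))
      simpa [hk] using this
  rw [hset, infinitePi_nonzeroSubseq_mem ν hν N t' ht'm, ← Finset.prod_subset hN]
  · exact Finset.prod_congr rfl fun i hi => by simp [ht', hi]
  · intro i _ hi; simp [ht', hi]

lemma nonzeroObs_iid {Ω : Type*} [MeasurableSpace Ω] (P : Measure Ω) [IsProbabilityMeasure P]
    (ν : Measure ℝ) [IsProbabilityMeasure ν] (hν : ν {0} < 1) (X : ℕ → Ω → ℝ)
    (hm : ∀ i, Measurable (X i)) (hi : iIndepFun X P) (hl : ∀ i, P.map (X i) = ν) :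
    (∀ k, Measurable (nonzeroObs X k)) ∧ iIndepFun (nonzeroObs X) P ∧
      ∀ k, P.map (nonzeroObs X k) = ν[|{0}ᶜ] := by
  have := isProbabilityMeasure_cond_ne_zero ν hν
  have hX : Measurable fun ω i => X i ω := measurable_pi_lambda _ hm
  have hmk : ∀ k, Measurable (nonzeroObs X k) := fun k =>
    (measurable_pi_apply k).comp (measurable_nonzeroSubseq.comp hX)
  have hjoint : P.map (fun ω k => nonzeroObs X k ω) = Measure.infinitePi fun _ : ℕ => ν[|{0}ᶜ] := by
    have h1 := hi.map_fun_eq_infinitePi_map hm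
    simp only [hl] at h1
    rw [← map_nonzeroSubseq_infinitePi ν hν, ← h1, Measure.map_map measurable_nonzeroSubseq hX]
    rfl
  have hlaw : ∀ k, P.map (nonzeroObs X k) = ν[|{0}ᶜ] := by
    intro k
    have h2 := Measure.map_map (measurable_pi_apply k) (measurable_pi_lambda _ hmk)
      (μ := P) (f := fun ω k => nonzeroObs X k ω)
    rw [hjoint, Measure.infinitePi_map_eval] at h2
    exact h2.symm
  refine ⟨hmk, ?_, hlaw⟩
  rw [iIndepFun_iff_map_fun_eq_infinitePi_map hmk, hjoint]
  simp only [hlaw]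

/-! ### The characteristic function of the nonzero observations -/

/-- The law with density `f`. -/
noncomputable def densityLaw (f : ℝ → ℝ) : Measure ℝ :=
  volume.withDensity fun x => ENNReal.ofReal (f x)

lemma IsDensity.isProbabilityMeasure {f : ℝ → ℝ} (hf : IsDensity f) :
    IsProbabilityMeasure (densityLaw f) := by
  constructor
  rw [densityLaw, withDensity_apply _ .univ, Measure.restrict_univ,
    ← ofReal_integral_eq_lintegral_ofReal hf.integrable (ae_of_all _ hf.nonneg),
    hf.integral_eq_one, ENNReal.ofReal_one]

lemma IsDensity.charFun_densityLaw {f : ℝ → ℝ} (hf : IsDensity f) (t : ℝ) :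
    charFun (densityLaw f) t = cf f t := by
  rw [charFun_apply_real, densityLaw, integral_withDensity_eq_integral_toReal_smul₀
    hf.integrable.aestronglyMeasurable.aemeasurable.ennreal_ofReal
    (ae_of_all _ fun _ => ENNReal.ofReal_lt_top), cf]
  refine integral_congr_ae (ae_of_all _ fun x => ?_)
  simp only [ENNReal.toReal_ofReal (hf.nonneg x), Complex.real_smul]
  rw [mul_comm]
  congr 2
  ring

lemma measurable_randomSum :
    Measurable fun p : ℕ × (ℕ → ℝ) => ∑ j ∈ Finset.range p.1, p.2 j :=
  measurable_from_prod_countable_right fun n =>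
    Finset.measurable_sum (Finset.range n) fun j _ => measurable_pi_apply j

instance isProbabilityMeasure_compoundPoissonLaw (lam : ℝ≥0) (μ : Measure ℝ)
    [IsProbabilityMeasure μ] : IsProbabilityMeasure (compoundPoissonLaw lam μ) :=
  Measure.isProbabilityMeasure_map measurable_randomSum.aemeasurable

lemma iIndepFun_eval (μ : Measure ℝ) [IsProbabilityMeasure μ] :
    iIndepFun (fun (j : ℕ) (y : ℕ → ℝ) => y j) (Measure.infinitePi fun _ : ℕ => μ) :=
  iIndepFun_infinitePi (P := fun _ : ℕ => μ) (X := fun _ y => y) fun _ => measurable_id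

lemma charFun_compoundPoissonLaw (lam : ℝ≥0) (μ : Measure ℝ) [IsProbabilityMeasure μ] (t : ℝ) :
    charFun (compoundPoissonLaw lam μ) t = Complex.exp (lam * charFun μ t - lam) := by
  have hmeas : Measurable fun x : ℝ => Complex.exp (t * x * Complex.I) := by fun_prop
  have hbound : ∀ x : ℝ, ‖Complex.exp (t * x * Complex.I)‖ ≤ 1 := fun x => by
    rw [← Complex.ofReal_mul, Complex.norm_exp_ofReal_mul_I]
  have hint : Integrable (fun p : ℕ × (ℕ → ℝ) =>
      Complex.exp (t * ((∑ j ∈ Finset.range p.1, p.2 j : ℝ) : ℂ) * Complex.I))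
      ((poissonMeasure lam).prod (Measure.infinitePi fun _ : ℕ => μ)) :=
    (integrable_const (1 : ℝ)).mono'
      (hmeas.comp measurable_randomSum).aestronglyMeasurable (ae_of_all _ fun p => hbound _)
  rw [charFun_apply_real, compoundPoissonLaw,
    integral_map measurable_randomSum.aemeasurable hmeas.aestronglyMeasurable,
    integral_prod _ hint]
  have hin : ∀ n : ℕ, ∫ y, Complex.exp (t * ((∑ j ∈ Finset.range n, y j : ℝ) : ℂ) * Complex.I)
      ∂(Measure.infinitePi fun _ : ℕ => μ) = charFun μ t ^ n := by
    intro n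
    have h := ((iIndepFun_eval μ).restrict (Finset.range n)).charFun_map_fun_finsetSum_eq_prod
      (s := Finset.range n)
      (fun j _ => (measurable_pi_apply j).aemeasurable)
    have h2 := congrFun h t
    simp only [Finset.prod_apply, Measure.infinitePi_map_eval, Finset.prod_const,
      Finset.card_range] at h2
    rw [← h2, charFun_apply_real, integral_map _ hmeas.aestronglyMeasurable]
    exact (Finset.measurable_sum _ fun j _ => measurable_pi_apply j).aemeasurable
  simp only [hin]
  rw [integral_poissonMeasure]
  have hexp : Complex.exp (lam * charFun μ t)
      = ∑' n : ℕ, (lam * charFun μ t) ^ n / (n.factorial : ℂ) := by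
    rw [Complex.exp_eq_exp_ℂ, NormedSpace.exp_eq_tsum_div]
  rw [sub_eq_add_neg, Complex.exp_add, hexp, ← tsum_mul_right]
  refine tsum_congr fun n => ?_
  rw [Complex.real_smul]
  push_cast
  rw [mul_pow]
  ring

/-- A sum of at least one summand with a density has no atom at `0`. -/
lemma IsDensity.sum_measure_zero {f : ℝ → ℝ} (hf : IsDensity f) (n : ℕ) :
    (Measure.infinitePi fun _ : ℕ => densityLaw f)
      {y | ∑ j ∈ Finset.range (n + 1), y j = 0} = 0 := by
  have := hf.isProbabilityMeasure
  set μ := densityLaw f with hμ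
  set Q := Measure.infinitePi fun _ : ℕ => μ with hQ
  have hatom : ∀ a : ℝ, μ {a} = 0 := fun a =>
    withDensity_absolutelyContinuous _ _ (measure_singleton a)
  have hind : IndepFun (∑ j ∈ Finset.range n, fun y : ℕ → ℝ => y j) (fun y : ℕ → ℝ => y n) Q :=
    (iIndepFun_eval μ).indepFun_finsetSum_of_notMem (fun j => measurable_pi_apply j)
      (Finset.notMem_range_self)
  have hm1 : Measurable (∑ j ∈ Finset.range n, fun y : ℕ → ℝ => y j) := by
    simp only [Finset.sum_fn]
    exact Finset.measurable_sum (Finset.range n) fun j _ => measurable_pi_apply j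
  have hm2 : Measurable fun y : ℕ → ℝ => y n := measurable_pi_apply n
  have hprod := (indepFun_iff_map_prod_eq_prod_map_map hm1.aemeasurable hm2.aemeasurable).1 hind
  have hmap : Q.map (fun y : ℕ → ℝ => y n) = μ := Measure.infinitePi_map_eval _ n
  have hS : MeasurableSet {p : ℝ × ℝ | p.1 + p.2 = 0} :=
    measurableSet_eq_fun (measurable_fst.add measurable_snd) measurable_const
  have hset : {y : ℕ → ℝ | ∑ j ∈ Finset.range (n + 1), y j = 0}
      = (fun y => ((∑ j ∈ Finset.range n, fun y : ℕ → ℝ => y j) y, y n)) ⁻¹'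
        {p : ℝ × ℝ | p.1 + p.2 = 0} := by
    ext y
    simp [Finset.sum_range_succ]
  rw [hset, ← Measure.map_apply (hm1.prodMk hm2) hS, hprod, hmap, Measure.prod_apply hS]
  have : ∀ s : ℝ, μ (Prod.mk s ⁻¹' {p : ℝ × ℝ | p.1 + p.2 = 0}) = 0 := by
    intro s
    have : Prod.mk s ⁻¹' {p : ℝ × ℝ | p.1 + p.2 = 0} = {-s} := by
      ext y
      simp only [Set.mem_preimage, Set.mem_ofPred_eq, Set.mem_singleton_iff]
      constructor <;> intro h <;> linarith
    rw [this, hatom]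
  rw [lintegral_congr this, lintegral_zero]

lemma IsDensity.compoundPoissonLaw_zero {f : ℝ → ℝ} (hf : IsDensity f) (lam : ℝ≥0) :
    compoundPoissonLaw lam (densityLaw f) {0} = ENNReal.ofReal (Real.exp (-lam)) := by
  have := hf.isProbabilityMeasure
  rw [compoundPoissonLaw, Measure.map_apply measurable_randomSum (measurableSet_singleton _),
    Measure.prod_apply (measurable_randomSum (measurableSet_singleton _)), lintegral_countable']
  rw [tsum_eq_single 0]
  · simp [poissonMeasure_singleton, Set.preimage_preimage]
  · intro n hn
    obtain ⟨m, rfl⟩ := Nat.exists_eq_succ_of_ne_zero hn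
    have := hf.sum_measure_zero m
    simp only [Set.preimage_preimage]
    rw [mul_eq_zero]; left
    exact this

lemma charFun_cond_ne_zero (ν : Measure ℝ) [IsProbabilityMeasure ν] (t : ℝ) :
    charFun (ν[|{0}ᶜ]) t = (charFun ν t - (ν.real {0} : ℂ)) / ((1 - ν.real {0} : ℝ) : ℂ) := by
  have hint : Integrable (fun x : ℝ => Complex.exp (t * x * Complex.I)) ν := by
    refine (integrable_const (1 : ℝ)).mono' (by fun_prop) (ae_of_all _ fun x => ?_)
    rw [← Complex.ofReal_mul, Complex.norm_exp_ofReal_mul_I]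
  have h1 := integral_add_compl (measurableSet_singleton (0 : ℝ)) hint
  rw [integral_singleton] at h1
  simp only [Complex.ofReal_zero, mul_zero, zero_mul, Complex.exp_zero, Complex.real_smul,
    mul_one] at h1
  rw [charFun_apply_real, charFun_apply_real, ← h1, ProbabilityTheory.cond, integral_smul_measure,
    ENNReal.toReal_inv, Complex.real_smul, ← measureReal_def,
    probReal_compl_eq_one_sub (measurableSet_singleton _)]
  push_cast
  rw [add_sub_cancel_left, div_eq_inv_mul]

/-- The law of the nonzero observations. -/
noncomputable def nonzeroLaw (lam : ℝ≥0) (f : ℝ → ℝ) : Measure ℝ :=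
  (compoundPoissonLaw lam (densityLaw f))[|{0}ᶜ]

lemma exp_sub_one_pos {lam : ℝ≥0} (hlam : 0 < lam) : 0 < Real.exp lam - 1 := by
  have : (0 : ℝ) < lam := hlam
  have := Real.add_one_lt_exp this.ne'
  linarith

lemma IsDensity.charFun_nonzeroLaw {f : ℝ → ℝ} (hf : IsDensity f) {lam : ℝ≥0} (hlam : 0 < lam)
    (t : ℝ) : ((Real.exp lam - 1 : ℝ) : ℂ) * charFun (nonzeroLaw lam f) t
      = Complex.exp (lam * cf f t) - 1 := by
  have := hf.isProbabilityMeasure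
  have hpos := exp_sub_one_pos hlam
  have h1 : (Complex.exp (lam : ℂ) - 1) ≠ 0 := by
    have : ((Real.exp lam - 1 : ℝ) : ℂ) ≠ 0 := by exact_mod_cast hpos.ne'
    simpa using this
  have h2 : (1 - (Complex.exp (lam : ℂ))⁻¹) ≠ 0 := by
    have h0 := Complex.exp_ne_zero (lam : ℂ)
    intro h
    apply h1
    field_simp at h
    simpa using h
  have h0 := Complex.exp_ne_zero (lam : ℂ)
  rw [nonzeroLaw, charFun_cond_ne_zero, charFun_compoundPoissonLaw, hf.charFun_densityLaw,
    measureReal_def, hf.compoundPoissonLaw_zero, ENNReal.toReal_ofReal (Real.exp_pos _).le,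
    Complex.exp_sub]
  push_cast
  rw [Complex.exp_neg]
  field_simp

lemma IsDensity.compoundPoissonLaw_zero_lt_one {f : ℝ → ℝ} (hf : IsDensity f) {lam : ℝ≥0}
    (hlam : 0 < lam) : compoundPoissonLaw lam (densityLaw f) {0} < 1 := by
  rw [hf.compoundPoissonLaw_zero, ENNReal.ofReal_lt_one, Real.exp_lt_one_iff]
  simpa using hlam

lemma IsDensity.isProbabilityMeasure_nonzeroLaw {f : ℝ → ℝ} (hf : IsDensity f) {lam : ℝ≥0}
    (hlam : 0 < lam) : IsProbabilityMeasure (nonzeroLaw lam f) := by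
  have := hf.isProbabilityMeasure
  exact isProbabilityMeasure_cond_ne_zero _ (hf.compoundPoissonLaw_zero_lt_one hlam)

lemma IsSample.nonzeroObs_iid {Ω : Type*} [MeasurableSpace Ω] {P : Measure Ω}
    [IsProbabilityMeasure P] {lam : ℝ≥0} {f : ℝ → ℝ} {X : ℕ → Ω → ℝ} (hX : IsSample P lam f X)
    (hf : IsDensity f) (hlam : 0 < lam) :
    (∀ k, Measurable (nonzeroObs X k)) ∧ iIndepFun (nonzeroObs X) P ∧
      ∀ k, P.map (nonzeroObs X k) = nonzeroLaw lam f := by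
  have := hf.isProbabilityMeasure
  exact Decompounding.nonzeroObs_iid P _ (hf.compoundPoissonLaw_zero_lt_one hlam) X hX.measurable
    hX.indep hX.law

/-! ### Distinguished logarithms -/

/-- Two continuous logarithms of the same path differ by a constant, since their difference takes
values in the discrete set `2πiℤ`. -/
lemma eq_of_exp_eq {L L' : ℝ → ℂ} (hL : Continuous L) (hL' : Continuous L')
    (h : ∀ t, Complex.exp (L t) = Complex.exp (L' t)) (h0 : L 0 = L' 0) : L = L' := by
  choose k hk using fun t => Complex.exp_eq_exp_iff_exists_int.1 (h t)
  have hkr : ∀ t, ((k t : ℤ) : ℝ) = (L t - L' t).im / (2 * Real.pi) := by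
    intro t
    rw [hk t]
    have := Real.pi_pos
    simp
  have hc : Continuous k := by
    rw [Int.isClosedEmbedding_coe_real.isEmbedding.continuous_iff]
    have : ((↑) : ℤ → ℝ) ∘ k = fun t => (L t - L' t).im / (2 * Real.pi) := funext hkr
    rw [this]
    fun_prop
  have hk0 : k 0 = 0 := by
    have := hkr 0
    rw [h0, sub_self, Complex.zero_im, zero_div] at this
    exact_mod_cast this
  funext t
  have : k t = 0 := by rw [← hk0]; exact PreconnectedSpace.constant inferInstance hc
  rw [hk t, this]
  simp

lemma distLog_eq {ψ L : ℝ → ℂ} (hL : Continuous L) (h0 : L 0 = Complex.log (ψ 0))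
    (h : ∀ t, Complex.exp (L t) = ψ t) : distLog ψ = L := by
  have H : ∃ L : ℝ → ℂ, Continuous L ∧ L 0 = Complex.log (ψ 0) ∧ ∀ t, Complex.exp (L t) = ψ t :=
    ⟨L, hL, h0, h⟩
  rw [distLog, dif_pos H]
  obtain ⟨h1, h2, h3⟩ := H.choose_spec
  exact eq_of_exp_eq h1 hL (fun t => by rw [h3, h]) (by rw [h2, h0])

/-- If `ψ` stays within relative distance less than `1` of `exp ∘ L`, its distinguished logarithm
is obtained from `L` by adding the principal logarithm of the quotient. -/
lemma continuous_add_log {ψ L : ℝ → ℂ} (hψ : Continuous ψ) (hL : Continuous L)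
    (hL0 : L 0 = Complex.log (ψ 0)) (h0 : Complex.exp (L 0) = ψ 0)
    (h : ∀ t, ‖ψ t / Complex.exp (L t) - 1‖ < 1) :
    Continuous (fun t => L t + Complex.log (ψ t / Complex.exp (L t))) ∧
      L 0 + Complex.log (ψ 0 / Complex.exp (L 0)) = Complex.log (ψ 0) ∧
      ∀ t, Complex.exp (L t + Complex.log (ψ t / Complex.exp (L t))) = ψ t := by
  have hmem : ∀ t, ψ t / Complex.exp (L t) ∈ Complex.slitPlane := by
    intro t
    have := Complex.mem_slitPlane_of_norm_lt_one (h t)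
    rwa [add_sub_cancel] at this
  refine ⟨?_, ?_, ?_⟩
  · refine hL.add (Continuous.clog ?_ hmem)
    exact hψ.div (Complex.continuous_exp.comp hL) fun t => Complex.exp_ne_zero _
  · rw [h0, div_self, Complex.log_one, add_zero, hL0]
    rw [← h0]; exact Complex.exp_ne_zero _
  · intro t
    rw [Complex.exp_add, Complex.exp_log (Complex.slitPlane_ne_zero (hmem t)),
      mul_div_cancel₀ _ (Complex.exp_ne_zero _)]

lemma distLog_eq_add_log {ψ L : ℝ → ℂ} (hψ : Continuous ψ) (hL : Continuous L)
    (hL0 : L 0 = Complex.log (ψ 0)) (h0 : Complex.exp (L 0) = ψ 0)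
    (h : ∀ t, ‖ψ t / Complex.exp (L t) - 1‖ < 1) :
    distLog ψ = fun t => L t + Complex.log (ψ t / Complex.exp (L t)) := by
  obtain ⟨h1, h2, h3⟩ := continuous_add_log hψ hL hL0 h0 h
  exact distLog_eq h1 h2 h3

/-! ### Measurability of the estimator -/

lemma cf_zero (w : ℝ → ℝ) (hw : ∫ u, w u = 1) : cf w 0 = 1 := by
  simp only [cf, Complex.ofReal_zero, mul_zero, zero_mul, Complex.exp_zero, one_mul]
  rw [integral_complex_ofReal, hw, Complex.ofReal_one]

lemma empCf_zero {n : ℕ} (hn : n ≠ 0) (z : ℕ → ℝ) : empCf n z 0 = 1 := by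
  have : (n : ℂ) ≠ 0 := by exact_mod_cast hn
  simp [empCf, this]

lemma path_zero (lam : ℝ≥0) {w : ℝ → ℝ} (hw : ∫ u, w u = 1) (h : ℝ) {n : ℕ} (hn : n ≠ 0)
    (z : ℕ → ℝ) : path lam w h n z 0 = Complex.exp lam := by
  simp [path, cf_zero w hw, empCf_zero hn]

lemma continuous_empCf (n : ℕ) : Continuous fun p : (ℕ → ℝ) × ℝ => empCf n p.1 p.2 := by
  unfold empCf
  refine continuous_const.mul (continuous_finsetSum _ fun j _ => ?_)
  have : Continuous fun p : (ℕ → ℝ) × ℝ => p.1 j := (continuous_apply j).comp continuous_fst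
  fun_prop

lemma continuous_path (lam : ℝ≥0) {w : ℝ → ℝ} (hw : Continuous (cf w)) (h : ℝ) (n : ℕ) :
    Continuous fun p : (ℕ → ℝ) × ℝ => path lam w h n p.1 p.2 := by
  unfold path
  have := continuous_empCf n
  fun_prop

lemma continuous_path_comp (lam : ℝ≥0) {w : ℝ → ℝ} (hw : Continuous (cf w)) (h : ℝ) (n : ℕ)
    {α : Type*} [TopologicalSpace α] {a : α → ℕ → ℝ} {b : α → ℝ} (ha : Continuous a)
    (hb : Continuous b) : Continuous fun q => path lam w h n (a q) (b q) := by
  have h1 : Continuous ((fun p : (ℕ → ℝ) × ℝ => path lam w h n p.1 p.2) ∘ fun q => (a q, b q)) :=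
    (continuous_path lam hw h n).comp (ha.prodMk hb)
  exact h1

lemma path_eq_one {lam : ℝ≥0} {w : ℝ → ℝ} (hs : ∀ t : ℝ, 1 < |t| → cf w t = 0) {h : ℝ}
    (hh : 0 < h) (n : ℕ) (z : ℕ → ℝ) {t : ℝ} (ht : t ∉ Set.Icc (-(1 / h)) (1 / h)) :
    path lam w h n z t = 1 := by
  have h1 : 1 < |h * t| := by
    rw [Set.mem_Icc, ← abs_le, not_le, div_lt_iff₀ hh] at ht
    rwa [abs_mul, abs_of_pos hh, mul_comm]
  simp [path, hs _ h1]

/-- The samples whose path has no zeros and has a distinguished logarithm. -/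
def logDomain (lam : ℝ≥0) (w : ℝ → ℝ) (h : ℝ) (n : ℕ) : Set (ℕ → ℝ) :=
  {z | ∃ L : ℝ → ℂ, Continuous L ∧ L 0 = Complex.log (path lam w h n z 0) ∧
    ∀ t, Complex.exp (L t) = path lam w h n z t}

/-- Off `[-1/h, 1/h]` the path is constantly `1`; on it compactness makes the closeness uniform. -/
lemma eventually_path_div_sub_one_lt {lam : ℝ≥0} {w : ℝ → ℝ} (hc : Continuous (cf w))
    (hs : ∀ t : ℝ, 1 < |t| → cf w t = 0) {h : ℝ} (hh : 0 < h) (n : ℕ) {z₀ : ℕ → ℝ}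
    (hz₀ : ∀ t, path lam w h n z₀ t ≠ 0) :
    ∀ᶠ z in 𝓝 z₀, ∀ t, ‖path lam w h n z t / path lam w h n z₀ t - 1‖ < 1 / 2 := by
  have hc2 : Continuous fun p : (ℕ → ℝ) × ℝ =>
      ‖path lam w h n p.1 p.2 / path lam w h n z₀ p.2 - 1‖ := by
    have h1 : Continuous fun p : (ℕ → ℝ) × ℝ => path lam w h n p.1 p.2 :=
      continuous_path_comp lam hc h n continuous_fst continuous_snd
    have h2 : Continuous fun p : (ℕ → ℝ) × ℝ => path lam w h n z₀ p.2 :=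
      continuous_path_comp lam hc h n continuous_const continuous_snd
    have h3 := h1.div h2 fun p => hz₀ _
    exact (h3.sub continuous_const).norm
  have key : ∀ᶠ z in 𝓝 z₀, ∀ t ∈ Set.Icc (-(1 / h)) (1 / h),
      ‖path lam w h n z t / path lam w h n z₀ t - 1‖ < 1 / 2 := by
    refine isCompact_Icc.eventually_forall_of_forall_eventually fun t _ => ?_
    refine (hc2.continuousAt (x := (z₀, t))).eventually_lt continuousAt_const ?_
    simp [div_self (hz₀ t)]
  filter_upwards [key] with z hz t
  by_cases ht : t ∈ Set.Icc (-(1 / h)) (1 / h)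
  · exact hz t ht
  · simp [path_eq_one hs hh n _ ht]

/-- Near a sample in `logDomain` the path moves uniformly little, so that its distinguished
logarithm moves continuously. -/
lemma isOpen_logDomain_and_continuousOn {lam : ℝ≥0} {w : ℝ → ℝ} (hw : ∫ u, w u = 1)
    (hc : Continuous (cf w)) (hs : ∀ t : ℝ, 1 < |t| → cf w t = 0) {h : ℝ} (hh : 0 < h) {n : ℕ}
    (hn : n ≠ 0) (x : ℝ) :
    IsOpen (logDomain lam w h n) ∧
      ContinuousOn (fun z => rawEstimator lam w h n z x) (logDomain lam w h n) := by
  have hcz : ∀ z, Continuous (path lam w h n z) := fun z =>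
    continuous_path_comp lam hc h n continuous_const continuous_id
  have main : ∀ z₀ ∈ logDomain lam w h n, (∀ᶠ z in 𝓝 z₀, z ∈ logDomain lam w h n) ∧
      ContinuousAt (fun z => rawEstimator lam w h n z x) z₀ := by
    rintro z₀ ⟨L, hL, hL0, hLe⟩
    have hne : ∀ t, path lam w h n z₀ t ≠ 0 := fun t => by
      rw [← hLe]; exact Complex.exp_ne_zero _
    have hev := eventually_path_div_sub_one_lt (lam := lam) hc hs hh n hne
    have hzero : ∀ z, path lam w h n z 0 = path lam w h n z₀ 0 := fun z => by
      rw [path_zero lam hw h hn, path_zero lam hw h hn]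
    have hlog : ∀ z, (∀ t, ‖path lam w h n z t / path lam w h n z₀ t - 1‖ < 1 / 2) →
        ∀ t, ‖path lam w h n z t / Complex.exp (L t) - 1‖ < 1 := by
      intro z hz t
      rw [hLe]
      exact (hz t).trans (by norm_num)
    have hdom : ∀ᶠ z in 𝓝 z₀, z ∈ logDomain lam w h n := by
      filter_upwards [hev] with z hz
      exact ⟨_, continuous_add_log (hcz z) hL (by rw [hzero, hL0]) (by rw [hzero, hLe])
        (hlog z hz)⟩
    refine ⟨hdom, ?_⟩
    have heq : ∀ᶠ z in 𝓝 z₀, rawEstimator lam w h n z x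
        = (1 / (2 * Real.pi * (lam : ℝ))) * (∫ t in (-(1 / h))..(1 / h),
          Complex.exp (-(Complex.I * (t : ℂ) * (x : ℂ))) *
            (L t + Complex.log (path lam w h n z t / Complex.exp (L t)))).re := by
      filter_upwards [hev, hdom] with z hz hd
      obtain ⟨L', -, -, hL'⟩ := hd
      have hne' : ∀ t, path lam w h n z t ≠ 0 := fun t => by
        rw [← hL']; exact Complex.exp_ne_zero _
      rw [rawEstimator, if_pos hne', distLog_eq_add_log (hcz z) hL (by rw [hzero, hL0])
        (by rw [hzero, hLe]) (hlog z hz)]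
    refine ContinuousAt.congr ?_ (heq.mono fun z hz => hz.symm)
    refine continuousAt_const.mul (Complex.continuous_re.continuousAt.comp ?_)
    refine intervalIntegral.continuousAt_of_dominated_interval (bound := fun t => ‖L t‖ + 1)
      ?_ ?_ ?_ ?_
    · filter_upwards [hev] with z hz
      have := (continuous_add_log (hcz z) hL (by rw [hzero, hL0]) (by rw [hzero, hLe])
        (hlog z hz)).1
      exact Continuous.aestronglyMeasurable (by fun_prop)
    · filter_upwards [hev] with z hz
      refine ae_of_all _ fun t _ => ?_
      have hexp : ‖Complex.exp (-(Complex.I * (t : ℂ) * (x : ℂ)))‖ = 1 := by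
        rw [show -(Complex.I * (t : ℂ) * (x : ℂ)) = ((-(t * x) : ℝ) : ℂ) * Complex.I by
          push_cast; ring, Complex.norm_exp_ofReal_mul_I]
      rw [norm_mul, hexp, one_mul]
      refine (norm_add_le _ _).trans (add_le_add_right ?_ _)
      have h1 := hz t
      rw [← hLe t] at h1
      have h2 := Complex.norm_log_one_add_half_le_self h1.le
      rw [add_sub_cancel] at h2
      linarith
    · exact Continuous.intervalIntegrable (by fun_prop) _ _
    · refine ae_of_all _ fun t _ => ?_
      have h1 : Continuous fun z => path lam w h n z t :=
        continuous_path_comp lam hc h n continuous_id continuous_const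
      refine continuousAt_const.mul (continuousAt_const.add (ContinuousAt.clog ?_ ?_))
      · exact (h1.div_const _).continuousAt
      · rw [hLe t, div_self (hne t)]; exact Complex.one_mem_slitPlane
  exact ⟨isOpen_iff_mem_nhds.2 fun z hz => (main z hz).1, fun z hz =>
    (main z hz).2.continuousWithinAt⟩

lemma rawEstimator_eq_zero {lam : ℝ≥0} {w : ℝ → ℝ} {h : ℝ} {n : ℕ} {z : ℕ → ℝ}
    (hz : z ∉ logDomain lam w h n) (x : ℝ) : rawEstimator lam w h n z x = 0 := by
  have : distLog (path lam w h n z) = 0 := dif_neg hz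
  simp [rawEstimator, this]

lemma measurable_rawEstimator {lam : ℝ≥0} {w : ℝ → ℝ} (hw : ∫ u, w u = 1)
    (hc : Continuous (cf w)) (hs : ∀ t : ℝ, 1 < |t| → cf w t = 0) {h : ℝ} (hh : 0 < h) {n : ℕ}
    (hn : n ≠ 0) (x : ℝ) : Measurable fun z => rawEstimator lam w h n z x := by
  classical
  obtain ⟨ho, hcont⟩ := isOpen_logDomain_and_continuousOn (lam := lam) hw hc hs hh hn x
  have : (fun z => rawEstimator lam w h n z x)
      = (logDomain lam w h n).piecewise (fun z => rawEstimator lam w h n z x) 0 := by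
    funext z
    by_cases hz : z ∈ logDomain lam w h n
    · simp [hz]
    · simp [hz, rawEstimator_eq_zero hz]
  rw [this]
  exact hcont.measurable_piecewise continuousOn_const ho.measurableSet

lemma measurable_estimator {lam : ℝ≥0} {w : ℝ → ℝ} (hw : ∫ u, w u = 1)
    (hc : Continuous (cf w)) (hs : ∀ t : ℝ, 1 < |t| → cf w t = 0) {h : ℝ} (hh : 0 < h) (M : ℝ)
    {n : ℕ} (hn : n ≠ 0) (x : ℝ) : Measurable fun z => estimator lam w h M n z x :=
  (measurable_const.min (measurable_rawEstimator hw hc hs hh hn x)).max measurable_const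

lemma abs_estimator_le (lam : ℝ≥0) (w : ℝ → ℝ) (h : ℝ) {M : ℝ} (hM : 0 ≤ M) (n : ℕ)
    (z : ℕ → ℝ) (x : ℝ) : |estimator lam w h M n z x| ≤ M := by
  rw [abs_le, estimator]
  exact ⟨le_max_right _ _, max_le (min_le_left _ _) (by linarith)⟩

/-! ### Averages of independent observations -/

/-- `Z 0, Z 1, …` are independent random variables with common law `μ`. -/
structure IsIID {Ω : Type*} [MeasurableSpace Ω] (P : Measure Ω) (μ : Measure ℝ)
    (Z : ℕ → Ω → ℝ) : Prop where
  measurable : ∀ k, Measurable (Z k)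
  indep : iIndepFun Z P
  law : ∀ k, P.map (Z k) = μ

section

variable {Ω : Type*} [MeasurableSpace Ω] {P : Measure Ω} {μ : Measure ℝ} {Z : ℕ → Ω → ℝ}

lemma integrable_of_bounded {α : Type*} [MeasurableSpace α] {ρ : Measure α} [IsFiniteMeasure ρ]
    {E : Type*} [NormedAddCommGroup E] {g : α → E} (hg : AEStronglyMeasurable g ρ) {K : ℝ}
    (hK : ∀ x, ‖g x‖ ≤ K) : Integrable g ρ :=
  (integrable_const K).mono' hg (ae_of_all _ hK)

lemma IsIID.integral_comp (hZ : IsIID P μ Z) (k : ℕ) {g : ℝ → ℝ} (hg : Measurable g) :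
    ∫ ω, g (Z k ω) ∂P = ∫ z, g z ∂μ := by
  rw [← hZ.law k, integral_map (hZ.measurable k).aemeasurable hg.aestronglyMeasurable]

lemma IsIID.integral_average [IsProbabilityMeasure P] (hZ : IsIID P μ Z)
    {g : ℝ → ℝ} (hg : Measurable g) {K : ℝ}
    (hK : ∀ z, |g z| ≤ K) {n : ℕ} (hn : n ≠ 0) :
    ∫ ω, (1 / (n : ℝ)) * ∑ j ∈ Finset.range n, g (Z j ω) ∂P = ∫ z, g z ∂μ := by
  have hn' : (n : ℝ) ≠ 0 := by exact_mod_cast hn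
  have hint : ∀ j ∈ Finset.range n, Integrable (fun ω => g (Z j ω)) P := fun j _ =>
    integrable_of_bounded (hg.comp (hZ.measurable j)).aestronglyMeasurable fun ω => hK _
  rw [integral_const_mul, integral_finsetSum _ hint]
  simp only [hZ.integral_comp _ hg, Finset.sum_const, Finset.card_range, nsmul_eq_mul]
  field_simp

/-- The mean squared error of the average of `n` independent copies is at most the second moment
divided by `n`. -/
lemma IsIID.integral_average_sub_sq_le [IsProbabilityMeasure P] (hZ : IsIID P μ Z)
    {g : ℝ → ℝ} (hg : Measurable g) {K : ℝ}
    (hK : ∀ z, |g z| ≤ K) {n : ℕ} (hn : n ≠ 0) :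
    ∫ ω, ((1 / (n : ℝ)) * ∑ j ∈ Finset.range n, g (Z j ω) - ∫ z, g z ∂μ) ^ 2 ∂P
      ≤ (1 / (n : ℝ)) * ∫ z, g z ^ 2 ∂μ := by
  have hn' : (n : ℝ) ≠ 0 := by exact_mod_cast hn
  have hm : ∀ j, Measurable fun ω => g (Z j ω) := fun j => hg.comp (hZ.measurable j)
  have hL : ∀ j, MemLp (fun ω => g (Z j ω)) 2 P := fun j =>
    MemLp.of_bound (hm j).aestronglyMeasurable K (ae_of_all _ fun ω => hK _)
  have hvar : variance (∑ j ∈ Finset.range n, fun ω => g (Z j ω)) P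
      = ∑ j ∈ Finset.range n, variance (fun ω => g (Z j ω)) P := by
    refine IndepFun.variance_sum (fun j _ => hL j) fun i _ j _ hij => ?_
    exact (hZ.indep.indepFun hij).comp hg hg
  have hle : ∀ j, variance (fun ω => g (Z j ω)) P ≤ ∫ z, g z ^ 2 ∂μ := by
    intro j
    refine (variance_le_expectation_sq (hm j).aestronglyMeasurable).trans_eq ?_
    exact hZ.integral_comp j (hg.pow_const 2)
  have hmean : Measurable fun ω => (1 / (n : ℝ)) * ∑ j ∈ Finset.range n, g (Z j ω) :=
    (Finset.measurable_sum _ fun j _ => hm j).const_mul _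
  calc ∫ ω, ((1 / (n : ℝ)) * ∑ j ∈ Finset.range n, g (Z j ω) - ∫ z, g z ∂μ) ^ 2 ∂P
      = variance (fun ω => (1 / (n : ℝ)) * ∑ j ∈ Finset.range n, g (Z j ω)) P := by
        rw [variance_eq_integral hmean.aemeasurable, hZ.integral_average hg hK hn]
    _ = (1 / (n : ℝ)) ^ 2 * ∑ j ∈ Finset.range n, variance (fun ω => g (Z j ω)) P := by
        rw [variance_const_mul, ← hvar, Finset.sum_fn]
    _ ≤ (1 / (n : ℝ)) ^ 2 * ∑ j ∈ Finset.range n, ∫ z, g z ^ 2 ∂μ := by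
        gcongr with j hj
        exact hle j
    _ = (1 / (n : ℝ)) * ∫ z, g z ^ 2 ∂μ := by
        rw [Finset.sum_const, Finset.card_range, nsmul_eq_mul]
        field_simp

lemma IsIID.measure_average_ge_le [IsProbabilityMeasure P] (hZ : IsIID P μ Z)
    {g : ℝ → ℝ} (hg : Measurable g)
    (hK : ∀ z, |g z| ≤ 2) {n : ℕ} (hn : n ≠ 0) {ε : ℝ} (hε : 0 ≤ ε) :
    P.real {ω | ε ≤ (1 / (n : ℝ)) * ∑ j ∈ Finset.range n, g (Z j ω) - ∫ z, g z ∂μ}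
      ≤ Real.exp (-(ε ^ 2 / 8) * n) := by
  have hn' : (0 : ℝ) < n := by exact_mod_cast Nat.pos_of_ne_zero hn
  have hm : ∀ j, Measurable fun ω => g (Z j ω) := fun j => hg.comp (hZ.measurable j)
  have hsub : ∀ j < n, HasSubgaussianMGF (fun ω => g (Z j ω) - ∫ z, g z ∂μ) 4 P := by
    intro j _
    have h := hasSubgaussianMGF_of_mem_Icc (μ := P) (a := -2) (b := 2) (hm j).aemeasurable
      (ae_of_all _ fun ω => abs_le.1 (hK (Z j ω)))
    rw [hZ.integral_comp j hg] at h
    convert h using 1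
    rw [← NNReal.coe_inj]
    norm_num
  have hind : iIndepFun (fun j ω => g (Z j ω) - ∫ z, g z ∂μ) P :=
    hZ.indep.comp (fun _ z => g z - ∫ z, g z ∂μ) fun _ => hg.sub_const _
  have h := HasSubgaussianMGF.measure_sum_range_ge_le_of_iIndepFun hind hsub
    (ε := n * ε) (by positivity)
  refine le_trans (le_of_eq ?_) (h.trans (le_of_eq ?_))
  · congr 1
    ext ω
    simp only [Set.mem_ofPred_eq, Finset.sum_sub_distrib, Finset.sum_const, Finset.card_range,
      nsmul_eq_mul]
    rw [← mul_le_mul_iff_right₀ hn', mul_sub, ← mul_assoc, mul_one_div_cancel hn'.ne', one_mul]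
  · congr 1
    push_cast
    field_simp
    norm_num
    ring

/-- Hoeffding's inequality, for functions bounded by `2`. -/
lemma IsIID.measure_abs_average_ge_le [IsProbabilityMeasure P] (hZ : IsIID P μ Z)
    {g : ℝ → ℝ} (hg : Measurable g)
    (hK : ∀ z, |g z| ≤ 2) {n : ℕ} (hn : n ≠ 0) {ε : ℝ} (hε : 0 ≤ ε) :
    P.real {ω | ε ≤ |(1 / (n : ℝ)) * ∑ j ∈ Finset.range n, g (Z j ω) - ∫ z, g z ∂μ|}
      ≤ 2 * Real.exp (-(ε ^ 2 / 8) * n) := by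
  have h1 := hZ.measure_average_ge_le hg hK hn hε
  have h2 := hZ.measure_average_ge_le hg.neg (fun z => by simpa using hK z) hn hε
  have hsub : {ω | ε ≤ |(1 / (n : ℝ)) * ∑ j ∈ Finset.range n, g (Z j ω) - ∫ z, g z ∂μ|}
      ⊆ {ω | ε ≤ (1 / (n : ℝ)) * ∑ j ∈ Finset.range n, g (Z j ω) - ∫ z, g z ∂μ}
        ∪ {ω | ε ≤ (1 / (n : ℝ)) * ∑ j ∈ Finset.range n, (-g) (Z j ω) - ∫ z, (-g) z ∂μ} := by
    intro ω hω
    simp only [Set.mem_ofPred_eq, Set.mem_union, Pi.neg_apply, Finset.sum_neg_distrib,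
      integral_neg] at hω ⊢
    rcases le_abs.1 hω with h | h
    · exact Or.inl h
    · right; linarith
  refine (measureReal_mono hsub).trans ((measureReal_union_le _ _).trans ?_)
  linarith

/-! ### The empirical characteristic function -/

lemma re_empCf (n : ℕ) (z : ℕ → ℝ) (t : ℝ) :
    (empCf n z t).re = (1 / (n : ℝ)) * ∑ j ∈ Finset.range n, Real.cos (t * z j) := by
  rw [empCf, show (1 / (n : ℂ)) = ((1 / (n : ℝ) : ℝ) : ℂ) by push_cast; rfl,
    Complex.re_ofReal_mul, Complex.re_sum]
  congr 1
  refine Finset.sum_congr rfl fun j _ => ?_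
  rw [show Complex.I * (t : ℂ) * (z j : ℂ) = ((t * z j : ℝ) : ℂ) * Complex.I by push_cast; ring,
    Complex.exp_ofReal_mul_I_re]

lemma im_empCf (n : ℕ) (z : ℕ → ℝ) (t : ℝ) :
    (empCf n z t).im = (1 / (n : ℝ)) * ∑ j ∈ Finset.range n, Real.sin (t * z j) := by
  rw [empCf, show (1 / (n : ℂ)) = ((1 / (n : ℝ) : ℝ) : ℂ) by push_cast; rfl,
    Complex.im_ofReal_mul, Complex.im_sum]
  congr 1
  refine Finset.sum_congr rfl fun j _ => ?_
  rw [show Complex.I * (t : ℂ) * (z j : ℂ) = ((t * z j : ℝ) : ℂ) * Complex.I by push_cast; ring,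
    Complex.exp_ofReal_mul_I_im]

lemma integrable_exp_mul_I [IsFiniteMeasure μ] (t : ℝ) :
    Integrable (fun x : ℝ => Complex.exp (t * x * Complex.I)) μ :=
  integrable_of_bounded (K := 1) (by fun_prop) fun x => by
    rw [← Complex.ofReal_mul, Complex.norm_exp_ofReal_mul_I]

lemma re_charFun [IsFiniteMeasure μ] (t : ℝ) : (charFun μ t).re = ∫ z, Real.cos (t * z) ∂μ := by
  rw [charFun_apply_real]
  refine (integral_re (integrable_exp_mul_I t)).symm.trans
    (integral_congr_ae (ae_of_all _ fun z => ?_))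
  change (Complex.exp (t * z * Complex.I)).re = _
  rw [← Complex.ofReal_mul, Complex.exp_ofReal_mul_I_re]

lemma im_charFun [IsFiniteMeasure μ] (t : ℝ) : (charFun μ t).im = ∫ z, Real.sin (t * z) ∂μ := by
  rw [charFun_apply_real]
  refine (integral_im (integrable_exp_mul_I t)).symm.trans
    (integral_congr_ae (ae_of_all _ fun z => ?_))
  change (Complex.exp (t * z * Complex.I)).im = _
  rw [← Complex.ofReal_mul, Complex.exp_ofReal_mul_I_im]

lemma measurable_empCf_comp (hZ : IsIID P μ Z) (n : ℕ) :
    Measurable fun p : Ω × ℝ => empCf n (fun k => Z k p.1) p.2 := by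
  have h1 : Measurable fun p : Ω × ℝ => ((fun k => Z k p.1 : ℕ → ℝ), p.2) :=
    (measurable_pi_lambda _ fun k => (hZ.measurable k).comp measurable_fst).prodMk measurable_snd
  have h2 : Measurable ((fun p : (ℕ → ℝ) × ℝ => empCf n p.1 p.2) ∘
      fun p : Ω × ℝ => ((fun k => Z k p.1 : ℕ → ℝ), p.2)) :=
    (continuous_empCf n).measurable.comp h1
  exact h2

lemma norm_empCf_le_one {n : ℕ} (hn : n ≠ 0) (z : ℕ → ℝ) (t : ℝ) : ‖empCf n z t‖ ≤ 1 := by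
  have hn' : (n : ℝ) ≠ 0 := by exact_mod_cast hn
  rw [empCf, norm_mul]
  have h1 : ‖∑ j ∈ Finset.range n, Complex.exp (Complex.I * (t : ℂ) * ((z j : ℝ) : ℂ))‖ ≤ n := by
    refine (norm_sum_le_of_le _ (f := fun j => Complex.exp (Complex.I * (t : ℂ) * ((z j : ℝ) : ℂ)))
      (n := fun _ => 1) fun j _ => ?_).trans (by simp)
    rw [show Complex.I * (t : ℂ) * (z j : ℂ) = ((t * z j : ℝ) : ℂ) * Complex.I by push_cast; ring,
      Complex.norm_exp_ofReal_mul_I]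
  have h2 : ‖(1 / (n : ℂ))‖ = 1 / (n : ℝ) := by simp
  rw [h2]
  calc 1 / (n : ℝ) * _ ≤ 1 / (n : ℝ) * n := by gcongr
    _ = 1 := by field_simp

lemma IsIID.integral_norm_empCf_sub_sq_le [IsProbabilityMeasure P] [IsProbabilityMeasure μ]
    (hZ : IsIID P μ Z) {n : ℕ} (hn : n ≠ 0) (t : ℝ) :
    ∫ ω, ‖empCf n (fun k => Z k ω) t - charFun μ t‖ ^ 2 ∂P ≤ 1 / (n : ℝ) := by
  have hc := hZ.integral_average_sub_sq_le (g := fun z => Real.cos (t * z)) (by fun_prop) (K := 1)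
    (fun z => Real.abs_cos_le_one _) hn
  have hs := hZ.integral_average_sub_sq_le (g := fun z => Real.sin (t * z)) (by fun_prop) (K := 1)
    (fun z => Real.abs_sin_le_one _) hn
  have hm := hZ.measurable
  have hdec : ∀ ω, ‖empCf n (fun k => Z k ω) t - charFun μ t‖ ^ 2
      = ((1 / (n : ℝ)) * ∑ j ∈ Finset.range n, Real.cos (t * Z j ω)
          - ∫ z, Real.cos (t * z) ∂μ) ^ 2
        + ((1 / (n : ℝ)) * ∑ j ∈ Finset.range n, Real.sin (t * Z j ω)
          - ∫ z, Real.sin (t * z) ∂μ) ^ 2 := by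
    intro ω
    rw [← Complex.normSq_eq_norm_sq, Complex.normSq_apply, Complex.sub_re, Complex.sub_im,
      re_empCf, im_empCf, re_charFun, im_charFun]
    ring
  have hbd : ∀ ω, ‖empCf n (fun k => Z k ω) t - charFun μ t‖ ≤ 2 := by
    intro ω
    have h1 := norm_empCf_le_one hn (fun k => Z k ω) t
    have h2 := norm_charFun_le_one (μ := μ) t
    exact (norm_sub_le _ _).trans (by linarith)
  have hic : Integrable (fun ω => ((1 / (n : ℝ)) * ∑ j ∈ Finset.range n, Real.cos (t * Z j ω)
          - ∫ z, Real.cos (t * z) ∂μ) ^ 2) P := by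
    refine integrable_of_bounded (K := 2 ^ 2) (Measurable.aestronglyMeasurable (by fun_prop))
      fun ω => ?_
    rw [Real.norm_of_nonneg (sq_nonneg _)]
    refine le_trans ?_ (pow_le_pow_left₀ (norm_nonneg _) (hbd ω) 2)
    rw [hdec]; linarith [sq_nonneg ((1 / (n : ℝ)) * ∑ j ∈ Finset.range n, Real.sin (t * Z j ω)
          - ∫ z, Real.sin (t * z) ∂μ)]
  have his : Integrable (fun ω => ((1 / (n : ℝ)) * ∑ j ∈ Finset.range n, Real.sin (t * Z j ω)
          - ∫ z, Real.sin (t * z) ∂μ) ^ 2) P := by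
    refine integrable_of_bounded (K := 2 ^ 2) (Measurable.aestronglyMeasurable (by fun_prop))
      fun ω => ?_
    rw [Real.norm_of_nonneg (sq_nonneg _)]
    refine le_trans ?_ (pow_le_pow_left₀ (norm_nonneg _) (hbd ω) 2)
    rw [hdec]; linarith [sq_nonneg ((1 / (n : ℝ)) * ∑ j ∈ Finset.range n, Real.cos (t * Z j ω)
          - ∫ z, Real.cos (t * z) ∂μ)]
  have hone : ∫ z, Real.cos (t * z) ^ 2 ∂μ + ∫ z, Real.sin (t * z) ^ 2 ∂μ = 1 := by
    rw [← integral_add]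
    · simp
    · refine integrable_of_bounded (K := 1) (by fun_prop) fun z => ?_
      rw [Real.norm_of_nonneg (sq_nonneg _)]; exact Real.cos_sq_le_one _
    · refine integrable_of_bounded (K := 1) (by fun_prop) fun z => ?_
      rw [Real.norm_of_nonneg (sq_nonneg _)]; exact Real.sin_sq_le_one _
  simp only [hdec]
  rw [integral_add hic his]
  refine (add_le_add hc hs).trans_eq ?_
  rw [← mul_add, hone, mul_one]

/-- The modulus of continuity of `t ↦ e^{itz}`, as a function of `z`. -/
lemma norm_exp_sub_exp_le {s t δ : ℝ} (hst : |t - s| ≤ δ) (z : ℝ) :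
    ‖Complex.exp (t * z * Complex.I) - Complex.exp (s * z * Complex.I)‖ ≤ min 2 (δ * |z|) := by
  have h1 : ∀ r : ℝ, ‖Complex.exp (r * z * Complex.I)‖ = 1 := fun r => by
    rw [← Complex.ofReal_mul, Complex.norm_exp_ofReal_mul_I]
  refine le_min ((norm_sub_le _ _).trans (by rw [h1, h1]; norm_num)) ?_
  have h2 : Complex.exp (t * z * Complex.I) - Complex.exp (s * z * Complex.I)
      = Complex.exp (s * z * Complex.I) *
        (Complex.exp (Complex.I * (((t - s) * z : ℝ) : ℂ)) - 1) := by
    rw [mul_sub, ← Complex.exp_add, mul_one]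
    congr 2
    push_cast; ring
  rw [h2, norm_mul, h1, one_mul]
  refine Real.norm_exp_I_mul_ofReal_sub_one_le.trans ?_
  rw [Real.norm_eq_abs, abs_mul]
  gcongr

lemma exists_integral_min_le [IsFiniteMeasure μ] {ε : ℝ} (hε : 0 < ε) :
    ∃ δ > 0, ∫ z, min 2 (δ * |z|) ∂μ ≤ ε := by
  have hlim : Tendsto (fun δ : ℝ => ∫ z, min 2 (δ * |z|) ∂μ) (𝓝[>] 0) (𝓝 (∫ _, (0 : ℝ) ∂μ)) := by
    refine tendsto_integral_filter_of_dominated_convergence (fun _ => 2) ?_ ?_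
      (integrable_const _) ?_
    · exact Eventually.of_forall fun δ => Continuous.aestronglyMeasurable (by fun_prop)
    · filter_upwards [self_mem_nhdsWithin] with δ hδ
      refine ae_of_all _ fun z => ?_
      have : (0 : ℝ) < δ := hδ
      rw [Real.norm_of_nonneg (le_min (by norm_num) (by positivity))]
      exact min_le_left _ _
    · refine ae_of_all _ fun z => ?_
      have : Continuous fun δ : ℝ => min 2 (δ * |z|) := by fun_prop
      have h := (this.tendsto 0).mono_left (nhdsWithin_le_nhds (s := Set.Ioi 0))
      simpa using h
  rw [integral_zero] at hlim
  obtain ⟨δ, h1, h2⟩ := ((hlim.eventually (ge_mem_nhds hε)).and self_mem_nhdsWithin).exists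
  exact ⟨δ, h2, h1⟩

/-- Uniform deviations of the empirical characteristic function over `[-T, T]` exceed a fixed level
with exponentially small probability. Hoeffding's inequality is applied on a grid of mesh `δ`, and
to the averages of `min 2 (δ |z|)`, which control the oscillation between grid points without any
moment condition on `μ`. -/
lemma IsIID.exists_uniform_deviation [IsProbabilityMeasure P] [IsProbabilityMeasure μ]
    (hZ : IsIID P μ Z) {ε : ℝ} (hε : 0 < ε) :
    ∃ A c : ℝ, 0 < A ∧ 0 < c ∧ ∀ n : ℕ, n ≠ 0 → ∀ T : ℝ, 0 ≤ T → ∃ G : Set Ω, MeasurableSet G ∧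
      P.real Gᶜ ≤ A * (1 + T) * Real.exp (-c * n) ∧
      ∀ ω ∈ G, ∀ t : ℝ, |t| ≤ T → ‖empCf n (fun k => Z k ω) t - charFun μ t‖ ≤ ε := by
  obtain ⟨δ, hδ, hδε⟩ := exists_integral_min_le (μ := μ) (ε := ε / 6) (by positivity)
  set q : ℝ → ℝ := fun z => min 2 (δ * |z|) with hq
  have hqm : Measurable q := by simp only [hq]; fun_prop
  have hq0 : ∀ z, 0 ≤ q z := fun z => le_min (by norm_num) (by positivity)
  have hqb : ∀ z, |q z| ≤ 2 := fun z => by rw [abs_of_nonneg (hq0 z)]; exact min_le_left _ _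
  set E : (ℝ → ℝ) → ℕ → Set Ω := fun g n =>
    {ω | ε / 6 ≤ |(1 / (n : ℝ)) * ∑ j ∈ Finset.range n, g (Z j ω) - ∫ z, g z ∂μ|} with hE
  have hEm : ∀ g, Measurable g → ∀ n, MeasurableSet (E g n) := by
    intro g hg n
    have hm : ∀ j, Measurable fun ω => g (Z j ω) := fun j => hg.comp (hZ.measurable j)
    exact measurableSet_le measurable_const
      (((Finset.measurable_sum _ fun j _ => hm j).const_mul _).sub_const _).abs
  set c : ℝ := (ε / 6) ^ 2 / 8 with hc
  have hEp : ∀ g, Measurable g → (∀ z, |g z| ≤ 2) → ∀ n, n ≠ 0 →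
      P.real (E g n) ≤ 2 * Real.exp (-c * n) := fun g hg hgb n hn =>
    hZ.measure_abs_average_ge_le hg hgb hn (by positivity)
  refine ⟨8 / δ + 14, c, by positivity, by positivity, fun n hn T hT => ?_⟩
  set N : ℕ := ⌈T / δ⌉₊ with hN
  set I : Finset ℤ := Finset.Icc (-(N : ℤ)) N with hI
  set C : ℤ → ℝ → ℝ := fun k z => Real.cos (k * δ * z) with hC
  set S : ℤ → ℝ → ℝ := fun k z => Real.sin (k * δ * z) with hS
  have hCm : ∀ k, Measurable (C k) := fun k => by simp only [hC]; fun_prop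
  have hSm : ∀ k, Measurable (S k) := fun k => by simp only [hS]; fun_prop
  set B : Set Ω := E q n ∪ ⋃ k ∈ I, (E (C k) n ∪ E (S k) n) with hB
  have hBm : MeasurableSet B := (hEm q hqm n).union
    (Finset.measurableSet_biUnion _ fun k _ => (hEm _ (hCm k) n).union (hEm _ (hSm k) n))
  refine ⟨Bᶜ, hBm.compl, ?_, ?_⟩
  · rw [compl_compl]
    have hcard : (I.card : ℝ) ≤ 2 * T / δ + 3 := by
      have h1 : I.card = 2 * N + 1 := by simp [hI]; omega
      have h2 : (N : ℝ) ≤ T / δ + 1 := (Nat.ceil_lt_add_one (by positivity)).le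
      rw [h1]; push_cast
      rw [mul_div_assoc]; linarith
    have hone : ∀ k ∈ I, P.real (E (C k) n ∪ E (S k) n) ≤ 4 * Real.exp (-c * n) := by
      intro k _
      have h1 := hEp (C k) (hCm k) (fun z => (Real.abs_cos_le_one _).trans (by norm_num)) n hn
      have h2 := hEp (S k) (hSm k) (fun z => (Real.abs_sin_le_one _).trans (by norm_num)) n hn
      linarith [measureReal_union_le (μ := P) (E (C k) n) (E (S k) n)]
    have hexp := Real.exp_pos (-c * n)
    calc P.real B ≤ P.real (E q n) + P.real (⋃ k ∈ I, (E (C k) n ∪ E (S k) n)) :=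
          measureReal_union_le _ _
      _ ≤ 2 * Real.exp (-c * n) + ∑ k ∈ I, P.real (E (C k) n ∪ E (S k) n) :=
          add_le_add (hEp q hqm hqb n hn) (measureReal_biUnion_finset_le _ _)
      _ ≤ 2 * Real.exp (-c * n) + ∑ k ∈ I, 4 * Real.exp (-c * n) := by
          gcongr with k hk
          exact hone k hk
      _ = (2 + 4 * I.card) * Real.exp (-c * n) := by
          rw [Finset.sum_const, nsmul_eq_mul]; ring
      _ ≤ (8 / δ + 14) * (1 + T) * Real.exp (-c * n) := by
          gcongr
          have h3 : 2 * T / δ = 2 * (T / δ) := mul_div_assoc _ _ _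
          have h4 : 0 ≤ 8 / δ := by positivity
          have h5 : 8 / δ * T = 8 * (T / δ) := by ring
          have h6 : 0 ≤ T / δ := by positivity
          nlinarith
  · intro ω hω t ht
    simp only [hB, Set.mem_compl_iff, Set.mem_union, Set.mem_iUnion, not_or, not_exists] at hω
    obtain ⟨hω1, hω2⟩ := hω
    set k : ℤ := ⌊t / δ⌋ with hk
    have hkt : |t - k * δ| ≤ δ := by
      have h1 : (k : ℝ) ≤ t / δ := Int.floor_le _
      have h2 : t / δ < k + 1 := Int.lt_floor_add_one _
      rw [le_div_iff₀ hδ] at h1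
      rw [div_lt_iff₀ hδ] at h2
      rw [abs_le]; constructor <;> linarith
    have hkI : k ∈ I := by
      have hTN : T / δ ≤ N := Nat.le_ceil _
      have ht1 : t / δ ≤ T / δ := by gcongr; exact (abs_le.1 ht).2
      have ht2 : -(T / δ) ≤ t / δ := by rw [← neg_div]; gcongr; exact (abs_le.1 ht).1
      rw [hI, Finset.mem_Icc]
      constructor
      · rw [hk, Int.le_floor]; push_cast; linarith
      · have : (k : ℝ) ≤ N := (Int.floor_le _).trans (ht1.trans hTN)
        exact_mod_cast this
    obtain ⟨h3, h4⟩ := hω2 k hkI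
    simp only [hE, Set.mem_ofPred_eq, not_le] at hω1 h3 h4
    have hexpI : ∀ (r : ℝ) (z : ℝ), Complex.I * (r : ℂ) * (z : ℂ) = r * z * Complex.I :=
      fun r z => by ring
    -- oscillation of the empirical characteristic function between `k δ` and `t`
    have hA : ‖empCf n (fun k => Z k ω) t - empCf n (fun k => Z k ω) (k * δ : ℝ)‖
        ≤ (1 / (n : ℝ)) * ∑ j ∈ Finset.range n, q (Z j ω) := by
      rw [empCf, empCf, ← mul_sub, norm_mul, ← Finset.sum_sub_distrib]
      have h2 : ‖(1 / (n : ℂ))‖ = 1 / (n : ℝ) := by simp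
      rw [h2]
      gcongr
      refine norm_sum_le_of_le _ fun j _ => ?_
      rw [hexpI, hexpI]
      exact norm_exp_sub_exp_le hkt _
    have hBd : ‖charFun μ t - charFun μ (k * δ : ℝ)‖ ≤ ∫ z, q z ∂μ := by
      rw [charFun_apply_real, charFun_apply_real, ← integral_sub (integrable_exp_mul_I _)
        (integrable_exp_mul_I _)]
      refine norm_integral_le_of_norm_le (integrable_of_bounded hqm.aestronglyMeasurable hqb)
        (ae_of_all _ fun z => norm_exp_sub_exp_le hkt z)
    have hD : ‖empCf n (fun k => Z k ω) (k * δ : ℝ) - charFun μ (k * δ : ℝ)‖ ≤ ε / 6 + ε / 6 := by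
      refine (Complex.norm_le_abs_re_add_abs_im _).trans ?_
      rw [Complex.sub_re, Complex.sub_im, re_empCf, im_empCf, re_charFun, im_charFun]
      exact add_le_add h3.le h4.le
    have hsplit : empCf n (fun k => Z k ω) t - charFun μ t
        = (empCf n (fun k => Z k ω) t - empCf n (fun k => Z k ω) (k * δ : ℝ))
          + (empCf n (fun k => Z k ω) (k * δ : ℝ) - charFun μ (k * δ : ℝ))
          - (charFun μ t - charFun μ (k * δ : ℝ)) := by ring
    rw [hsplit]
    refine (norm_sub_le _ _).trans ?_
    have h7 := norm_add_le (empCf n (fun k => Z k ω) t - empCf n (fun k => Z k ω) (k * δ : ℝ))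
      (empCf n (fun k => Z k ω) (k * δ : ℝ) - charFun μ (k * δ : ℝ))
    have h8 := (abs_lt.1 hω1).2
    linarith

end

/-! ### Linear functionals of the empirical characteristic function -/

/-- The integral of `a t * e^{itz}` over `[-T, T]`, as a function of `z`. -/
noncomputable def truncFourier (a : ℝ → ℂ) (T z : ℝ) : ℂ :=
  ∫ t in (-T)..T, a t * Complex.exp (t * z * Complex.I)

lemma continuous_truncFourier {a : ℝ → ℂ} (ha : Continuous a) (T : ℝ) :
    Continuous (truncFourier a T) := by
  unfold truncFourier
  exact intervalIntegral.continuous_parametric_intervalIntegral_of_continuous' (by fun_prop) _ _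

lemma norm_truncFourier_le {a : ℝ → ℂ} {A : ℝ} (hA : ∀ t, ‖a t‖ ≤ A) {T : ℝ} (hT : 0 ≤ T)
    (z : ℝ) : ‖truncFourier a T z‖ ≤ A * (2 * T) := by
  refine (intervalIntegral.norm_integral_le_of_norm_le_const (C := A) fun t _ => ?_).trans_eq ?_
  · rw [norm_mul, ← Complex.ofReal_mul, Complex.norm_exp_ofReal_mul_I, mul_one]
    exact hA t
  · rw [abs_of_nonneg (by linarith)]; ring

section

variable {Ω : Type*} {μ : Measure ℝ} {Z : ℕ → Ω → ℝ}

lemma integrable_truncFourier [IsFiniteMeasure μ] {a : ℝ → ℂ} (ha : Continuous a) {A : ℝ}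
    (hA : ∀ t, ‖a t‖ ≤ A) {T : ℝ} (hT : 0 ≤ T) : Integrable (truncFourier a T) μ :=
  integrable_of_bounded (continuous_truncFourier ha T).aestronglyMeasurable
    fun z => norm_truncFourier_le hA hT z

lemma integral_truncFourier [IsFiniteMeasure μ] {a : ℝ → ℂ} (ha : Continuous a) {A : ℝ}
    (hA : ∀ t, ‖a t‖ ≤ A) {T : ℝ} (hT : 0 ≤ T) :
    ∫ z, truncFourier a T z ∂μ = ∫ t in (-T)..T, a t * charFun μ t := by
  simp only [truncFourier, intervalIntegral.integral_of_le (show -T ≤ T by linarith)]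
  rw [integral_integral_swap]
  · refine integral_congr_ae (ae_of_all _ fun t => ?_)
    simp only [charFun_apply_real, integral_const_mul]
  · refine integrable_of_bounded (K := A) (Continuous.aestronglyMeasurable ?_) fun p => ?_
    · unfold Function.uncurry; fun_prop
    · simp only [Function.uncurry]
      rw [norm_mul, ← Complex.ofReal_mul, Complex.norm_exp_ofReal_mul_I, mul_one]
      exact hA _

/-- Expanding the square, the left side is the integral of `a t * conj (a s) * charFun μ (t - s)`
over the square `[-T, T]²`. This gains a factor `T` over the trivial bound `(2 * T * A) ^ 2`. -/
lemma integral_norm_truncFourier_sq_le [IsFiniteMeasure μ] (hμ : Integrable (charFun μ))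
    {a : ℝ → ℂ} (ha : Continuous a) {A : ℝ} (hA : ∀ t, ‖a t‖ ≤ A) {T : ℝ} (hT : 0 ≤ T) :
    ∫ z, ‖truncFourier a T z‖ ^ 2 ∂μ ≤ A ^ 2 * (2 * T) * ∫ t, ‖charFun μ t‖ := by
  have hA0 : 0 ≤ A := (norm_nonneg _).trans (hA 0)
  set ν : Measure ℝ := volume.restrict (Set.Ioc (-T) T) with hν
  have hexp : ∀ r : ℝ, ‖Complex.exp (r * Complex.I)‖ = 1 := Complex.norm_exp_ofReal_mul_I
  set F : ℝ → ℝ × ℝ → ℂ := fun z p =>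
    a p.1 * starRingEnd ℂ (a p.2) * Complex.exp ((p.1 - p.2 : ℝ) * z * Complex.I) with hF
  have hsq : ∀ z, ((‖truncFourier a T z‖ ^ 2 : ℝ) : ℂ) = ∫ p, F z p ∂(ν.prod ν) := by
    intro z
    have h1 : truncFourier a T z = ∫ t, a t * Complex.exp (t * z * Complex.I) ∂ν := by
      rw [truncFourier, intervalIntegral.integral_of_le (by linarith)]
    have h2 : starRingEnd ℂ (truncFourier a T z)
        = ∫ s, starRingEnd ℂ (a s * Complex.exp (s * z * Complex.I)) ∂ν := by
      rw [h1, integral_conj]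
    have h3 : ((‖truncFourier a T z‖ ^ 2 : ℝ) : ℂ)
        = truncFourier a T z * starRingEnd ℂ (truncFourier a T z) := by
      rw [Complex.mul_conj, Complex.normSq_eq_norm_sq]
    rw [h3, h2, h1, ← integral_prod_mul]
    refine integral_congr_ae (ae_of_all _ fun p => ?_)
    simp only [hF, map_mul, ← Complex.exp_conj, Complex.conj_ofReal, Complex.conj_I]
    rw [show ((p.1 - p.2 : ℝ) : ℂ) * z * Complex.I
      = p.1 * z * Complex.I + p.2 * z * -Complex.I by push_cast; ring, Complex.exp_add]
    ring
  have hFn : ∀ z p, ‖F z p‖ ≤ A ^ 2 := by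
    intro z p
    simp only [hF]
    rw [norm_mul, norm_mul, RCLike.norm_conj, ← Complex.ofReal_mul, hexp, mul_one, sq]
    exact mul_le_mul (hA _) (hA _) (norm_nonneg _) hA0
  have hFi : Integrable (Function.uncurry F) (μ.prod (ν.prod ν)) := by
    refine integrable_of_bounded (K := A ^ 2) (Continuous.aestronglyMeasurable ?_) fun p => hFn _ _
    have : Continuous fun t => starRingEnd ℂ (a t) := Complex.continuous_conj.comp ha
    unfold Function.uncurry; simp only [hF]; fun_prop
  have hmain : ((∫ z, ‖truncFourier a T z‖ ^ 2 ∂μ : ℝ) : ℂ)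
      = ∫ p, a p.1 * starRingEnd ℂ (a p.2) * charFun μ (p.1 - p.2) ∂(ν.prod ν) := by
    rw [← integral_complex_ofReal]
    simp only [hsq]
    rw [integral_integral_swap hFi]
    refine integral_congr_ae (ae_of_all _ fun p => ?_)
    simp only [hF, integral_const_mul, charFun_apply_real]
  have hint : Integrable (fun p : ℝ × ℝ => A ^ 2 * ‖charFun μ (p.1 - p.2)‖) (ν.prod ν) := by
    refine integrable_of_bounded (K := A ^ 2 * μ.real Set.univ) ?_ fun p => ?_
    · exact ((measurable_charFun.comp (measurable_fst.sub measurable_snd)).norm.const_mul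
        _).aestronglyMeasurable
    · rw [Real.norm_of_nonneg (by positivity)]
      gcongr
      exact norm_charFun_le _
  have hle : ∫ z, ‖truncFourier a T z‖ ^ 2 ∂μ
      ≤ ∫ p, A ^ 2 * ‖charFun μ (p.1 - p.2)‖ ∂(ν.prod ν) := by
    have h0 : 0 ≤ ∫ z, ‖truncFourier a T z‖ ^ 2 ∂μ := integral_nonneg fun z => by positivity
    rw [← abs_of_nonneg h0, ← Real.norm_eq_abs, ← Complex.norm_real, hmain]
    refine norm_integral_le_of_norm_le hint (ae_of_all _ fun p => ?_)
    rw [norm_mul, norm_mul, RCLike.norm_conj, sq]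
    gcongr
    · exact hA _
    · exact hA _
  refine hle.trans ?_
  rw [integral_prod_symm _ hint]
  have hin : ∀ s, ∫ t, A ^ 2 * ‖charFun μ (t - s)‖ ∂ν ≤ A ^ 2 * ∫ t, ‖charFun μ t‖ := by
    intro s
    rw [integral_const_mul]
    gcongr
    calc ∫ t, ‖charFun μ (t - s)‖ ∂ν ≤ ∫ t, ‖charFun μ (t - s)‖ :=
          setIntegral_le_integral (hμ.norm.comp_sub_right s)
            (ae_of_all _ fun t => norm_nonneg _)
      _ = ∫ t, ‖charFun μ t‖ := integral_sub_right_eq_self (fun t => ‖charFun μ t‖) s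
  calc ∫ s, ∫ t, A ^ 2 * ‖charFun μ (t - s)‖ ∂ν ∂ν
      ≤ ∫ _, (A ^ 2 * ∫ t, ‖charFun μ t‖) ∂ν :=
        integral_mono hint.integral_prod_right (integrable_const _) hin
    _ = A ^ 2 * (2 * T) * ∫ t, ‖charFun μ t‖ := by
        rw [integral_const, hν, measureReal_restrict_apply_univ,
          Real.volume_real_Ioc_of_le (by linarith)]
        simp only [smul_eq_mul]; ring

/-- The linear term of the expansion of the estimator. -/
noncomputable def linearTerm (a : ℝ → ℂ) (T : ℝ) (n : ℕ) (μ : Measure ℝ) (Z : ℕ → Ω → ℝ) (ω : Ω) :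
    ℝ :=
  (∫ t in (-T)..T, a t * (empCf n (fun k => Z k ω) t - charFun μ t)).re

lemma continuous_empCf_right (n : ℕ) (z : ℕ → ℝ) : Continuous (empCf n z) := by
  unfold empCf; fun_prop

lemma linearTerm_eq [IsFiniteMeasure μ] {a : ℝ → ℂ} (ha : Continuous a) {A : ℝ}
    (hA : ∀ t, ‖a t‖ ≤ A) {T : ℝ} (hT : 0 ≤ T) (n : ℕ) (ω : Ω) :
    linearTerm a T n μ Z ω = (1 / (n : ℝ)) * ∑ j ∈ Finset.range n, (truncFourier a T (Z j ω)).re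
      - ∫ z, (truncFourier a T z).re ∂μ := by
  have hcf : IntervalIntegrable (fun t => a t * charFun μ t) volume (-T) T :=
    intervalIntegrable_charFun.continuousOn_mul ha.continuousOn
  have hec : Continuous (empCf n fun k => Z k ω) := continuous_empCf_right _ _
  have hemp : IntervalIntegrable (fun t => a t * empCf n (fun k => Z k ω) t) volume (-T) T :=
    (ha.mul hec).intervalIntegrable _ _
  simp only [linearTerm, mul_sub]
  rw [intervalIntegral.integral_sub hemp hcf, Complex.sub_re, ← integral_truncFourier ha hA hT]
  congr 1
  · have h1 : ∫ t in (-T)..T, a t * empCf n (fun k => Z k ω) t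
        = (1 / (n : ℂ)) * ∑ j ∈ Finset.range n, truncFourier a T (Z j ω) := by
      simp only [truncFourier]
      rw [← intervalIntegral.integral_finsetSum, ← intervalIntegral.integral_const_mul]
      · refine intervalIntegral.integral_congr fun t _ => ?_
        simp only [empCf]
        rw [mul_left_comm, Finset.mul_sum]
        congr 1
        refine Finset.sum_congr rfl fun j _ => ?_
        congr 2; ring
      · intro j _
        exact Continuous.intervalIntegrable (by fun_prop) _ _
    rw [h1, show (1 / (n : ℂ)) = ((1 / (n : ℝ) : ℝ) : ℂ) by push_cast; rfl,
      Complex.re_ofReal_mul, Complex.re_sum]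
  · exact (integral_re (integrable_truncFourier ha hA hT)).symm

lemma abs_re_truncFourier_le {a : ℝ → ℂ} {A : ℝ} (hA : ∀ t, ‖a t‖ ≤ A) {T : ℝ} (hT : 0 ≤ T)
    (z : ℝ) : |(truncFourier a T z).re| ≤ A * (2 * T) :=
  (Complex.abs_re_le_norm _).trans (norm_truncFourier_le hA hT z)

lemma measurable_re_truncFourier {a : ℝ → ℂ} (ha : Continuous a) (T : ℝ) :
    Measurable fun z => (truncFourier a T z).re :=
  (Complex.continuous_re.comp (continuous_truncFourier ha T)).measurable

lemma measurable_linearTerm [MeasurableSpace Ω] {P : Measure Ω} [IsFiniteMeasure μ]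
    (hZ : IsIID P μ Z) {a : ℝ → ℂ}
    (ha : Continuous a) {A : ℝ} (hA : ∀ t, ‖a t‖ ≤ A) {T : ℝ} (hT : 0 ≤ T) (n : ℕ) :
    Measurable (linearTerm a T n μ Z) := by
  have : linearTerm a T n μ Z = _ := funext fun ω => linearTerm_eq ha hA hT n ω
  rw [this]
  have hm : ∀ j, Measurable fun ω => (truncFourier a T (Z j ω)).re := fun j =>
    (measurable_re_truncFourier ha T).comp (hZ.measurable j)
  exact ((Finset.measurable_sum _ fun j _ => hm j).const_mul _).sub_const _

lemma abs_linearTerm_le [IsProbabilityMeasure μ] {a : ℝ → ℂ} {A : ℝ}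
    (hA : ∀ t, ‖a t‖ ≤ A) {T : ℝ} (hT : 0 ≤ T) {n : ℕ} (hn : n ≠ 0) (ω : Ω) :
    |linearTerm a T n μ Z ω| ≤ A * (4 * T) := by
  refine (Complex.abs_re_le_norm _).trans ?_
  refine (intervalIntegral.norm_integral_le_of_norm_le_const (C := A * 2) fun t _ => ?_).trans_eq ?_
  · rw [norm_mul]
    have h1 := norm_empCf_le_one hn (fun k => Z k ω) t
    have h2 := norm_charFun_le_one (μ := μ) t
    exact mul_le_mul (hA t) ((norm_sub_le _ _).trans (by linarith)) (norm_nonneg _)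
      ((norm_nonneg _).trans (hA t))
  · rw [abs_of_nonneg (by linarith)]; ring

lemma integral_linearTerm [MeasurableSpace Ω] {P : Measure Ω} [IsProbabilityMeasure P]
    [IsProbabilityMeasure μ] (hZ : IsIID P μ Z)
    {a : ℝ → ℂ} (ha : Continuous a) {A : ℝ} (hA : ∀ t, ‖a t‖ ≤ A) {T : ℝ} (hT : 0 ≤ T)
    {n : ℕ} (hn : n ≠ 0) : ∫ ω, linearTerm a T n μ Z ω ∂P = 0 := by
  have hm : ∀ j, Measurable fun ω => (truncFourier a T (Z j ω)).re := fun j =>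
    (measurable_re_truncFourier ha T).comp (hZ.measurable j)
  have hint : Integrable (fun ω => (1 / (n : ℝ)) *
      ∑ j ∈ Finset.range n, (truncFourier a T (Z j ω)).re) P :=
    (integrable_finsetSum _ fun j _ => integrable_of_bounded (hm j).aestronglyMeasurable
      fun ω => abs_re_truncFourier_le hA hT _).const_mul _
  simp only [linearTerm_eq ha hA hT]
  rw [integral_sub hint (integrable_const _), hZ.integral_average
    (measurable_re_truncFourier ha T) (abs_re_truncFourier_le hA hT) hn]
  simp

lemma integral_linearTerm_sq_le [MeasurableSpace Ω] {P : Measure Ω} [IsProbabilityMeasure P]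
    [IsProbabilityMeasure μ]
    (hZ : IsIID P μ Z) (hμ : Integrable (charFun μ)) {a : ℝ → ℂ} (ha : Continuous a) {A : ℝ}
    (hA : ∀ t, ‖a t‖ ≤ A) {T : ℝ} (hT : 0 ≤ T) {n : ℕ} (hn : n ≠ 0) :
    ∫ ω, linearTerm a T n μ Z ω ^ 2 ∂P
      ≤ (1 / (n : ℝ)) * (A ^ 2 * (2 * T) * ∫ t, ‖charFun μ t‖) := by
  simp only [linearTerm_eq ha hA hT]
  refine (hZ.integral_average_sub_sq_le (measurable_re_truncFourier ha T)
    (abs_re_truncFourier_le hA hT) hn).trans ?_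
  gcongr
  refine le_trans ?_ (integral_norm_truncFourier_sq_le hμ ha hA hT)
  refine integral_mono_of_nonneg (ae_of_all _ fun z => sq_nonneg _) ?_ (ae_of_all _ fun z => ?_)
  · refine integrable_of_bounded (K := (A * (2 * T)) ^ 2)
      ((continuous_truncFourier ha T).norm.pow 2).aestronglyMeasurable fun z => ?_
    rw [Real.norm_of_nonneg (by positivity)]
    exact pow_le_pow_left₀ (norm_nonneg _) (norm_truncFourier_le hA hT z) 2
  · exact sq_le_sq' (neg_le_of_abs_le (Complex.abs_re_le_norm _)) (Complex.re_le_norm _)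

/-- The squared `L²` distance on `[-T, T]` between the empirical and the true characteristic
function. -/
noncomputable def quadTerm (T : ℝ) (n : ℕ) (μ : Measure ℝ) (Z : ℕ → Ω → ℝ) (ω : Ω) : ℝ :=
  ∫ t in (-T)..T, ‖empCf n (fun k => Z k ω) t - charFun μ t‖ ^ 2

lemma integrable_quadTerm_and_integral_le [MeasurableSpace Ω] {P : Measure Ω}
    [IsProbabilityMeasure P] [IsProbabilityMeasure μ]
    (hZ : IsIID P μ Z) {T : ℝ} (hT : 0 ≤ T) {n : ℕ} (hn : n ≠ 0) :
    Integrable (quadTerm T n μ Z) P ∧ ∫ ω, quadTerm T n μ Z ω ∂P ≤ 2 * T / n := by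
  set ν : Measure ℝ := volume.restrict (Set.Ioc (-T) T) with hν
  have hq : quadTerm T n μ Z
      = fun ω => ∫ t, ‖empCf n (fun k => Z k ω) t - charFun μ t‖ ^ 2 ∂ν := by
    funext ω
    rw [quadTerm, intervalIntegral.integral_of_le (by linarith)]
  have hint : Integrable (fun p : Ω × ℝ =>
      ‖empCf n (fun k => Z k p.1) p.2 - charFun μ p.2‖ ^ 2) (P.prod ν) := by
    refine integrable_of_bounded (K := 2 ^ 2) ?_ fun p => ?_
    · exact (((measurable_empCf_comp hZ n).sub
        (measurable_charFun.comp measurable_snd)).norm.pow_const 2).aestronglyMeasurable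
    · rw [Real.norm_of_nonneg (by positivity)]
      have h1 := norm_empCf_le_one hn (fun k => Z k p.1) p.2
      have h2 := norm_charFun_le_one (μ := μ) p.2
      exact pow_le_pow_left₀ (norm_nonneg _) ((norm_sub_le _ _).trans (by linarith)) 2
  refine ⟨by rw [hq]; exact hint.integral_prod_left, ?_⟩
  rw [hq, integral_integral_swap hint]
  calc ∫ t, ∫ ω, ‖empCf n (fun k => Z k ω) t - charFun μ t‖ ^ 2 ∂P ∂ν
      ≤ ∫ _, 1 / (n : ℝ) ∂ν := integral_mono hint.integral_prod_right (integrable_const _)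
        fun t => hZ.integral_norm_empCf_sub_sq_le hn t
    _ = 2 * T / n := by
        rw [integral_const, hν, measureReal_restrict_apply_univ,
          Real.volume_real_Ioc_of_le (by linarith)]
        simp only [smul_eq_mul]; ring

end

/-! ### The bias of the kernel and Fourier inversion -/

/-- The Taylor polynomial with the terms of order `j < β` approximates `e^{iy}` up to `|y| ^ β`: the
next term governs `|y| ≤ 1`, and for `|y| ≥ 1` each term by itself is at most `|y| ^ β`. -/
lemma exists_taylor_bound {β : ℝ} (hβ : 0 < β) :
    ∃ K : ℝ, 0 ≤ K ∧ ∀ y : ℝ, ‖Complex.exp (Complex.I * y)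
      - ∑ j ∈ Finset.range ⌈β⌉₊, (Complex.I * y) ^ j / (j.factorial : ℂ)‖ ≤ K * |y| ^ β := by
  set m := ⌈β⌉₊ with hm
  refine ⟨Real.exp 1 + (1 + m), by positivity, fun y => ?_⟩
  have hIy : ‖Complex.I * (y : ℂ)‖ = |y| := by simp
  have hyβ : 0 ≤ |y| ^ β := by positivity
  rcases le_total |y| 1 with hy | hy
  · have h1 := Complex.norm_exp_sub_sum_le_norm_mul_exp (Complex.I * y) m
    rw [hIy] at h1
    refine h1.trans ?_
    have h2 : |y| ^ m ≤ |y| ^ β := by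
      rcases (abs_nonneg y).eq_or_lt with h0 | h0
      · rw [← h0, Real.zero_rpow hβ.ne', zero_pow (Nat.ceil_pos.2 hβ).ne']
      · rw [← Real.rpow_natCast]
        exact Real.rpow_le_rpow_of_exponent_ge h0 hy (Nat.le_ceil β)
    have h3 : Real.exp |y| ≤ Real.exp 1 := Real.exp_le_exp.2 hy
    calc |y| ^ m * Real.exp |y| ≤ |y| ^ β * Real.exp 1 := by gcongr
      _ ≤ (Real.exp 1 + (1 + m)) * |y| ^ β := by
        rw [mul_comm]; gcongr; linarith [(Nat.cast_nonneg m : (0 : ℝ) ≤ m)]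
  · have hone : 1 ≤ |y| ^ β := Real.one_le_rpow hy hβ.le
    have h1 : ‖Complex.exp (Complex.I * y)‖ = 1 := by
      rw [mul_comm, Complex.norm_exp_ofReal_mul_I]
    have h2 : ‖∑ j ∈ Finset.range m, (Complex.I * y) ^ j / (j.factorial : ℂ)‖
        ≤ ∑ j ∈ Finset.range m, |y| ^ β := by
      refine norm_sum_le_of_le _ fun j hj => ?_
      rw [norm_div, norm_pow, hIy, Complex.norm_natCast]
      have hjβ : (j : ℝ) ≤ β := (Nat.lt_ceil.1 (Finset.mem_range.1 hj)).le
      have hf : (1 : ℝ) ≤ j.factorial := by exact_mod_cast j.factorial_pos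
      calc |y| ^ j / (j.factorial : ℝ) ≤ |y| ^ j := div_le_self (by positivity) hf
        _ ≤ |y| ^ β := by
          rw [← Real.rpow_natCast]; exact Real.rpow_le_rpow_of_exponent_le hy hjβ
    rw [Finset.sum_const, Finset.card_range, nsmul_eq_mul] at h2
    refine (norm_sub_le _ _).trans ?_
    rw [h1]
    have := Real.exp_pos 1
    nlinarith

/-- The kernel has order `β`: all its moments of order `1 ≤ j < β` vanish, so that only the
Taylor remainder of `e^{isu}` contributes to `cf w s - 1`. -/
lemma ConditionW.exists_norm_cf_sub_one_le {β : ℝ} (hβ : 0 < β) {w : ℝ → ℝ}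
    (hW : ConditionW β w) : ∃ C : ℝ, 0 ≤ C ∧ ∀ s : ℝ, ‖cf w s - 1‖ ≤ C * |s| ^ β := by
  obtain ⟨K, hK, hT⟩ := exists_taylor_bound hβ
  have hmom : ∀ j < ⌈β⌉₊, Integrable fun u : ℝ => (u : ℂ) ^ j * (w u : ℂ) := by
    intro j hj
    have h1 := (hW.integrable_moment j (Nat.le_floor (Nat.lt_ceil.1 hj).le)).ofReal (𝕜 := ℂ)
    refine h1.congr (ae_of_all _ fun u => ?_)
    simp
  have hwi : Integrable fun u : ℝ => (w u : ℂ) := by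
    simpa using hmom 0 (Nat.ceil_pos.2 hβ)
  refine ⟨K * ∫ u, |u| ^ β * |w u|, mul_nonneg hK (integral_nonneg fun u => by positivity),
    fun s => ?_⟩
  set p : ℕ → ℝ → ℂ := fun j u => (Complex.I * ((s * u : ℝ) : ℂ)) ^ j / (j.factorial : ℂ) * w u
    with hp
  have hpe : ∀ j, p j = fun u : ℝ =>
      ((Complex.I * s) ^ j / (j.factorial : ℂ)) * ((u : ℂ) ^ j * (w u : ℂ)) := by
    intro j; funext u; simp only [hp]; push_cast; ring
  have hpi : ∀ j ∈ Finset.range ⌈β⌉₊, Integrable (p j) := by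
    intro j hj
    rw [hpe]
    exact (hmom j (Finset.mem_range.1 hj)).const_mul _
  have hpint : ∀ j ∈ Finset.range ⌈β⌉₊, ∫ u, p j u = if j = 0 then 1 else 0 := by
    intro j hj
    rw [hpe, integral_const_mul]
    have h2 : ∫ u : ℝ, (u : ℂ) ^ j * (w u : ℂ) = ((∫ u : ℝ, u ^ j * w u : ℝ) : ℂ) := by
      rw [← integral_complex_ofReal]
      exact integral_congr_ae (ae_of_all _ fun u => by simp)
    rw [h2]
    split_ifs with h0
    · subst h0
      simp [hW.integral_eq_one]
    · rw [hW.moment_eq_zero j (Nat.one_le_iff_ne_zero.2 h0) (Nat.lt_ceil.1 (Finset.mem_range.1 hj))]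
      simp
  have hsum : ∫ u, ∑ j ∈ Finset.range ⌈β⌉₊, p j u = 1 := by
    rw [integral_finsetSum _ hpi, Finset.sum_congr rfl hpint, Finset.sum_ite_eq', if_pos]
    exact Finset.mem_range.2 (Nat.ceil_pos.2 hβ)
  have hei : Integrable fun u : ℝ =>
      Complex.exp (Complex.I * (s : ℂ) * (u : ℂ)) * ((w u : ℝ) : ℂ) := by
    refine hwi.bdd_mul (c := 1) (Continuous.aestronglyMeasurable (by fun_prop))
      (ae_of_all _ fun u => ?_)
    rw [show Complex.I * (s : ℂ) * (u : ℂ) = ((s * u : ℝ) : ℂ) * Complex.I by push_cast; ring,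
      Complex.norm_exp_ofReal_mul_I]
  rw [cf, ← hsum, ← integral_sub hei (integrable_finsetSum _ hpi), mul_assoc, mul_comm (∫ _, _),
    mul_comm K, ← integral_const_mul, ← integral_mul_const]
  refine norm_integral_le_of_norm_le ((hW.integrable_abs_moment.const_mul _).mul_const _)
    (ae_of_all _ fun u => ?_)
  simp only [hp]
  rw [← Finset.sum_mul, ← sub_mul, norm_mul, mul_assoc, ← Complex.ofReal_mul, Complex.norm_real,
    Real.norm_eq_abs]
  refine (mul_le_mul_of_nonneg_right (hT (s * u)) (abs_nonneg _)).trans_eq ?_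
  rw [abs_mul, Real.mul_rpow (abs_nonneg _) (abs_nonneg _)]
  ring

section Density

variable {f : ℝ → ℝ}

lemma IsDensity.norm_cf_le_one (hf : IsDensity f) (t : ℝ) : ‖cf f t‖ ≤ 1 := by
  have := hf.isProbabilityMeasure
  rw [← hf.charFun_densityLaw]
  exact norm_charFun_le_one t

lemma continuous_cf {u : ℝ → ℝ} (hu : Integrable u) : Continuous (cf u) := by
  refine continuous_of_dominated (bound := fun x => ‖u x‖) ?_ ?_ hu.norm ?_
  · intro t
    exact (Continuous.aestronglyMeasurable (by fun_prop)).mul hu.ofReal.aestronglyMeasurable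
  · intro t
    refine ae_of_all _ fun x => ?_
    rw [show Complex.I * (t : ℂ) * (x : ℂ) = ((t * x : ℝ) : ℂ) * Complex.I by push_cast; ring,
      norm_mul, Complex.norm_exp_ofReal_mul_I, one_mul, Complex.norm_real]
  · refine ae_of_all _ fun x => ?_
    fun_prop

lemma ConditionF.integrable_cf_self {β L₁ L₂ : ℝ} (hβ : 0 < β) (hF : ConditionF β L₁ L₂ f) :
    Integrable (cf f) := by
  have hcont := continuous_cf hF.density.integrable
  have h1 : Integrable ((Set.Icc (-1 : ℝ) 1).indicator fun _ => (1 : ℝ)) := by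
    rw [integrable_indicator_iff measurableSet_Icc]
    exact integrableOn_const (by simp)
  refine (h1.add hF.integrable_cf.norm).mono' hcont.aestronglyMeasurable (ae_of_all _ fun t => ?_)
  simp only [Pi.add_apply, norm_mul, Complex.norm_real, Real.norm_eq_abs]
  have hp : 0 ≤ |t| ^ β := by positivity
  rw [abs_of_nonneg hp]
  by_cases ht : t ∈ Set.Icc (-1 : ℝ) 1
  · rw [Set.indicator_of_mem ht]
    have := hF.density.norm_cf_le_one t
    have : 0 ≤ |t| ^ β * ‖cf f t‖ := by positivity
    linarith
  · rw [Set.indicator_of_notMem ht, zero_add]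
    have h2 : 1 ≤ |t| := by
      rw [Set.mem_Icc, ← abs_le, not_le] at ht; exact ht.le
    have h3 : 1 ≤ |t| ^ β := Real.one_le_rpow h2 hβ.le
    nlinarith [norm_nonneg (cf f t)]

lemma ConditionF.integrable_rpow_mul_norm_cf {β L₁ L₂ : ℝ} (hF : ConditionF β L₁ L₂ f) :
    Integrable fun t : ℝ => |t| ^ β * ‖cf f t‖ := by
  refine hF.integrable_cf.norm.congr (ae_of_all _ fun t => ?_)
  have : (0 : ℝ) ≤ |t| ^ β := by positivity
  simp only [norm_mul, Complex.norm_real, Real.norm_of_nonneg this]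

lemma fourier_eq_cf (f : ℝ → ℝ) (ξ : ℝ) :
    FourierTransform.fourier (fun x => (f x : ℂ)) ξ = cf f (-(2 * Real.pi) * ξ) := by
  rw [Real.fourier_real_eq_integral_exp_smul, cf]
  refine integral_congr_ae (ae_of_all _ fun x => ?_)
  simp only [smul_eq_mul]
  congr 2
  push_cast; ring

lemma ConditionF.continuous {β L₁ L₂ : ℝ} (hβ : 0 < β) (hF : ConditionF β L₁ L₂ f) :
    Continuous f := by
  rcases Nat.eq_zero_or_pos ⌊β⌋₊ with h0 | h0
  · have hH := hF.holder.2
    simp only [h0, iteratedDeriv_zero, Nat.cast_zero, sub_zero] at hH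
    refine continuous_iff_continuousAt.2 fun x => ?_
    rw [ContinuousAt, tendsto_iff_dist_tendsto_zero]
    have hlim : Tendsto (fun y => L₁ * |y - x| ^ β) (𝓝 x) (𝓝 0) := by
      have hc : Continuous fun y => L₁ * |y - x| ^ β :=
        continuous_const.mul ((continuous_id.sub continuous_const).abs.rpow_const
          fun _ => Or.inr hβ.le)
      have := hc.tendsto x
      simpa [Real.zero_rpow hβ.ne'] using this
    refine squeeze_zero (fun _ => dist_nonneg) (fun y => ?_) hlim
    have := hH x (y - x)
    rwa [add_sub_cancel] at this
  · have := hF.holder.1 0 h0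
    rw [iteratedDeriv_zero] at this
    exact this.continuous

lemma ConditionF.inversion {β L₁ L₂ : ℝ} (hβ : 0 < β) (hF : ConditionF β L₁ L₂ f) (x : ℝ) :
    (f x : ℂ) = (1 / (2 * Real.pi) : ℝ) *
      ∫ t : ℝ, Complex.exp (-(Complex.I * (t : ℂ) * (x : ℂ))) * cf f t := by
  have hpi := Real.pi_pos
  have hne : -(2 * Real.pi) ≠ 0 := by linarith
  have hci := hF.integrable_cf_self hβ
  have hfour : FourierTransform.fourier (fun x => (f x : ℂ))
      = fun ξ => cf f (-(2 * Real.pi) * ξ) := funext (fourier_eq_cf f)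
  have hfi : Integrable (FourierTransform.fourier fun x => (f x : ℂ)) := by
    rw [hfour]; exact hci.comp_mul_left' hne
  have hinv := hF.density.integrable.ofReal (𝕜 := ℂ) |>.fourierInv_fourier_eq hfi
    (v := x) (Complex.continuous_ofReal.comp (hF.continuous hβ)).continuousAt
  refine hinv.symm.trans ?_
  have hfour' : FourierTransform.fourier (fun x => ((f x : ℝ) : ℂ))
      = fun ξ => cf f (-(2 * Real.pi) * ξ) := hfour
  rw [Real.fourierInv_eq']
  have hsub := Measure.integral_comp_mul_left
    (fun t : ℝ => Complex.exp (-(Complex.I * (t : ℂ) * (x : ℂ))) * cf f t) (-(2 * Real.pi))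
  have habs : |(-(2 * Real.pi))⁻¹| = 1 / (2 * Real.pi) := by
    rw [abs_inv, abs_neg, abs_of_pos (by positivity), one_div]
  rw [habs, Complex.real_smul] at hsub
  rw [← hsub]
  refine integral_congr_ae (ae_of_all _ fun v => ?_)
  simp only [smul_eq_mul]
  refine congrArg₂ _ (congrArg _ ?_) (congrFun hfour' v)
  simp only [RCLike.inner_apply, conj_trivial]
  push_cast; ring

lemma tendsto_cf_zero (f : ℝ → ℝ) : Tendsto (cf f) (cocompact ℝ) (𝓝 0) := by
  have hpi := Real.pi_pos
  have hne : -(2 * Real.pi)⁻¹ ≠ 0 := by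
    have : (2 * Real.pi)⁻¹ ≠ 0 := by positivity
    exact neg_ne_zero.2 this
  have h1 := (Real.zero_at_infty_fourier fun x => (f x : ℂ)).comp
    (tendsto_cocompact_mul_left₀ hne)
  refine h1.congr fun t => ?_
  simp only [Function.comp]
  rw [fourier_eq_cf]
  congr 1
  field_simp

end Density

lemma norm_exp_sub_one_le (u : ℂ) : ‖Complex.exp u - 1‖ ≤ ‖u‖ * Real.exp ‖u‖ := by
  simpa using Complex.norm_exp_sub_sum_le_norm_mul_exp u 1

lemma ConditionF.integrable_charFun_nonzeroLaw {β L₁ L₂ : ℝ} (hβ : 0 < β) {f : ℝ → ℝ}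
    (hF : ConditionF β L₁ L₂ f) {lam : ℝ≥0} (hlam : 0 < lam) :
    Integrable (charFun (nonzeroLaw lam f)) := by
  have := hF.density.isProbabilityMeasure_nonzeroLaw hlam
  have hpos := exp_sub_one_pos hlam
  have hci := hF.integrable_cf_self hβ
  refine (hci.norm.const_mul ((Real.exp lam - 1)⁻¹ * (lam * Real.exp lam))).mono'
    measurable_charFun.aestronglyMeasurable (ae_of_all _ fun t => ?_)
  have h1 := congrArg norm (hF.density.charFun_nonzeroLaw hlam t)
  rw [norm_mul, Complex.norm_real, Real.norm_of_nonneg hpos.le] at h1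
  have h2 := norm_exp_sub_one_le (lam * cf f t)
  have h3 : ‖(lam : ℂ) * cf f t‖ = lam * ‖cf f t‖ := by simp
  have h4 : ‖(lam : ℂ) * cf f t‖ ≤ lam := by
    rw [h3]; exact mul_le_of_le_one_right lam.coe_nonneg (hF.density.norm_cf_le_one t)
  have h5 : ‖(lam : ℂ) * cf f t‖ * Real.exp ‖(lam : ℂ) * cf f t‖
      ≤ (lam * ‖cf f t‖) * Real.exp lam := by
    rw [← h3]; gcongr
  rw [mul_assoc, inv_mul_eq_div, le_div_iff₀ hpos]
  linarith

/-! ### Expansion of the estimator -/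

section Expansion

variable {β L₁ L₂ : ℝ} {f w : ℝ → ℝ} {lam : ℝ≥0}

/-- The coefficient of `empCf - charFun` in the relative error `path / exp (lam * cf f) - 1`. -/
noncomputable def stochCoeff (lam : ℝ≥0) (f w : ℝ → ℝ) (h t : ℝ) : ℂ :=
  Complex.exp (-(lam * cf f t)) * ((Real.exp lam - 1 : ℝ) : ℂ) * cf w (h * t)

/-- The deterministic part of the relative error `path / exp (lam * cf f) - 1`. -/
noncomputable def detError (lam : ℝ≥0) (f w : ℝ → ℝ) (h t : ℝ) : ℂ :=
  (1 - Complex.exp (-(lam * cf f t))) * (cf w (h * t) - 1)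

lemma path_div_exp_sub_one (hf : IsDensity f) (hlam : 0 < lam) (w : ℝ → ℝ) (h : ℝ) (n : ℕ)
    (z : ℕ → ℝ) (t : ℝ) :
    path lam w h n z t / Complex.exp (lam * cf f t) - 1
      = stochCoeff lam f w h t * (empCf n z t - charFun (nonzeroLaw lam f) t)
        + detError lam f w h t := by
  have h1 := hf.charFun_nonzeroLaw hlam t
  have hne := Complex.exp_ne_zero (lam * cf f t)
  rw [path, stochCoeff, detError, Complex.exp_neg]
  field_simp
  linear_combination (cf w (h * t)) * h1

lemma ConditionW.exists_norm_cf_le (hW : ConditionW β w) :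
    ∃ W : ℝ, 0 < W ∧ ∀ s, ‖cf w s‖ ≤ W := by
  have hwi : Integrable w := by simpa using hW.integrable_moment 0 (Nat.zero_le _)
  refine ⟨(∫ u, ‖w u‖) + 1, by positivity, fun s => ?_⟩
  rw [cf]
  refine (norm_integral_le_of_norm_le hwi.norm (ae_of_all _ fun u => ?_)).trans (by linarith)
  rw [show Complex.I * (s : ℂ) * (u : ℂ) = ((s * u : ℝ) : ℂ) * Complex.I by push_cast; ring,
    norm_mul, Complex.norm_exp_ofReal_mul_I, one_mul, Complex.norm_real]

lemma norm_lam_mul_cf_le (hf : IsDensity f) (t : ℝ) : ‖(lam : ℂ) * cf f t‖ ≤ lam := by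
  have h3 : ‖(lam : ℂ) * cf f t‖ = lam * ‖cf f t‖ := by simp
  rw [h3]
  exact mul_le_of_le_one_right lam.coe_nonneg (hf.norm_cf_le_one t)

lemma norm_stochCoeff_le (hf : IsDensity f) (hlam : 0 < lam) {W : ℝ} (hWb : ∀ s, ‖cf w s‖ ≤ W)
    (h t : ℝ) : ‖stochCoeff lam f w h t‖ ≤ Real.exp lam * (Real.exp lam - 1) * W := by
  have hpos := exp_sub_one_pos hlam
  rw [stochCoeff, norm_mul, norm_mul, Complex.norm_real, Real.norm_of_nonneg hpos.le]
  gcongr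
  · exact (Complex.norm_exp_le_exp_norm _).trans
      (Real.exp_le_exp.2 (by rw [norm_neg]; exact norm_lam_mul_cf_le hf t))
  · exact hWb _

lemma norm_detError_le (hf : IsDensity f) (h t : ℝ) :
    ‖detError lam f w h t‖ ≤ lam * Real.exp lam * ‖cf f t‖ * ‖cf w (h * t) - 1‖ := by
  rw [detError, norm_mul]
  gcongr
  rw [norm_sub_rev]
  refine (norm_exp_sub_one_le _).trans ?_
  have h1 := norm_lam_mul_cf_le (lam := lam) hf t
  have h3 : ‖(lam : ℂ) * cf f t‖ = lam * ‖cf f t‖ := by simp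
  rw [norm_neg]
  calc ‖(lam : ℂ) * cf f t‖ * Real.exp ‖(lam : ℂ) * cf f t‖
      ≤ ‖(lam : ℂ) * cf f t‖ * Real.exp lam := by gcongr
    _ = lam * Real.exp lam * ‖cf f t‖ := by rw [h3]; ring

/-- For small bandwidths, uniform closeness of the empirical characteristic function on
`[-1/h, 1/h]` keeps the path within relative distance `1/2` of `exp (lam * cf f)` on the whole
line. For large `|t|` the deterministic error is small because `cf f` vanishes at infinity, for
bounded `|t|` because `cf w (h * t)` is close to `1`. -/
lemma exists_norm_path_div_exp_sub_one_le (hβ : 0 < β) (hf : IsDensity f) (hW : ConditionW β w)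
    (hlam : 0 < lam) :
    ∃ ε h₀ : ℝ, 0 < ε ∧ 0 < h₀ ∧ ∀ h : ℝ, 0 < h → h < h₀ → ∀ (n : ℕ) (z : ℕ → ℝ),
      (∀ t : ℝ, |t| ≤ 1 / h → ‖empCf n z t - charFun (nonzeroLaw lam f) t‖ ≤ ε) →
      ∀ t : ℝ, ‖path lam w h n z t / Complex.exp (lam * cf f t) - 1‖ ≤ 1 / 2 := by
  obtain ⟨W, hW0, hWb⟩ := hW.exists_norm_cf_le
  obtain ⟨C, hC0, hC⟩ := hW.exists_norm_cf_sub_one_le hβ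
  have hpos := exp_sub_one_pos hlam
  have hl : (0 : ℝ) < lam := hlam
  set A := Real.exp lam * (Real.exp lam - 1) * W with hA
  have hA0 : 0 < A := by positivity
  set D := lam * Real.exp lam with hD
  have hD0 : 0 < D := by positivity
  have hev : ∀ᶠ t in cocompact ℝ, ‖cf f t‖ < 1 / (4 * D * (W + 1)) := by
    have h1 := (tendsto_cf_zero f).norm
    rw [norm_zero] at h1
    exact h1.eventually_lt_const (by positivity)
  rw [← Metric.cobounded_eq_cocompact,
    (Metric.hasBasis_cobounded_compl_closedBall 0).eventually_iff] at hev
  obtain ⟨R, -, hR⟩ := hev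
  have hsmall : ∀ᶠ h in 𝓝[>] (0 : ℝ), D * (C * (h * |R|) ^ β) < 1 / 4 := by
    have hc : Continuous fun h : ℝ => D * (C * (h * |R|) ^ β) :=
      continuous_const.mul (continuous_const.mul
        ((continuous_id.mul continuous_const).rpow_const fun _ => Or.inr hβ.le))
    have h1 : Tendsto (fun h : ℝ => D * (C * (h * |R|) ^ β)) (𝓝[>] 0) (𝓝 0) := by
      have := (hc.tendsto 0).mono_left (nhdsWithin_le_nhds (s := Set.Ioi 0))
      simpa [Real.zero_rpow hβ.ne'] using this
    exact h1.eventually_lt_const (by norm_num)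
  rw [eventually_nhdsWithin_iff, Metric.eventually_nhds_iff] at hsmall
  obtain ⟨h₀, hh₀, hsm⟩ := hsmall
  refine ⟨1 / (4 * A), h₀, by positivity, hh₀, fun h hh hlt n z hz t => ?_⟩
  rw [path_div_exp_sub_one hf hlam]
  have hstoch : ‖stochCoeff lam f w h t * (empCf n z t - charFun (nonzeroLaw lam f) t)‖
      ≤ 1 / 4 := by
    by_cases ht : |t| ≤ 1 / h
    · rw [norm_mul]
      calc _ ≤ A * (1 / (4 * A)) := mul_le_mul (norm_stochCoeff_le hf hlam hWb h t) (hz t ht)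
            (norm_nonneg _) hA0.le
        _ = 1 / 4 := by field_simp
    · have h1 : 1 < |h * t| := by
        rw [not_le, div_lt_iff₀ hh] at ht
        rwa [abs_mul, abs_of_pos hh, mul_comm]
      simp [stochCoeff, hW.cf_support _ h1]
  have hdet : ‖detError lam f w h t‖ ≤ 1 / 4 := by
    refine (norm_detError_le hf h t).trans ?_
    by_cases ht : |t| ≤ R
    · have h2 : ‖cf w (h * t) - 1‖ ≤ C * (h * |R|) ^ β := by
        refine (hC _).trans ?_
        rw [abs_mul, abs_of_pos hh]
        have hR' : |t| ≤ |R| := ht.trans (le_abs_self R)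
        gcongr
      have h3 := hsm (y := h) (by simpa [abs_of_pos hh] using hlt) hh
      have h4 := hf.norm_cf_le_one t
      calc D * ‖cf f t‖ * ‖cf w (h * t) - 1‖ ≤ D * 1 * (C * (h * |R|) ^ β) := by gcongr
        _ ≤ 1 / 4 := by rw [mul_one]; exact h3.le
    · have h2 : ‖cf f t‖ < 1 / (4 * D * (W + 1)) := hR (by simpa using ht)
      have h3 : ‖cf w (h * t) - 1‖ ≤ W + 1 :=
        (norm_sub_le _ _).trans (by rw [norm_one]; linarith [hWb (h * t)])
      calc D * ‖cf f t‖ * ‖cf w (h * t) - 1‖ ≤ D * (1 / (4 * D * (W + 1))) * (W + 1) := by gcongr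
        _ = 1 / 4 := by field_simp
  exact (norm_add_le _ _).trans (by linarith)

lemma norm_log_one_add_sub_le {q : ℂ} (hq : ‖q‖ ≤ 1 / 2) :
    ‖Complex.log (1 + q) - q‖ ≤ ‖q‖ ^ 2 := by
  refine (Complex.norm_log_one_add_sub_self_le (by linarith)).trans ?_
  have h1 : (1 - ‖q‖)⁻¹ ≤ 2 := by
    rw [inv_le_comm₀ (by linarith) (by norm_num)]; linarith
  have h2 : 0 ≤ ‖q‖ ^ 2 := by positivity
  nlinarith

/-- The weight against which `empCf - charFun` is integrated in the linear term. -/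
noncomputable def linearWeight (lam : ℝ≥0) (f w : ℝ → ℝ) (h x t : ℝ) : ℂ :=
  ((1 / (2 * Real.pi * (lam : ℝ)) : ℝ) : ℂ) *
    (Complex.exp (-(Complex.I * (t : ℂ) * (x : ℂ))) * stochCoeff lam f w h t)

lemma norm_exp_neg_I_mul (t x : ℝ) : ‖Complex.exp (-(Complex.I * (t : ℂ) * (x : ℂ)))‖ = 1 := by
  rw [show -(Complex.I * (t : ℂ) * (x : ℂ)) = ((-(t * x) : ℝ) : ℂ) * Complex.I by
    push_cast; ring, Complex.norm_exp_ofReal_mul_I]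

lemma norm_linearWeight_le (hf : IsDensity f) (hlam : 0 < lam) {W : ℝ} (hWb : ∀ s, ‖cf w s‖ ≤ W)
    (h x t : ℝ) : ‖linearWeight lam f w h x t‖
      ≤ 1 / (2 * Real.pi * lam) * (Real.exp lam * (Real.exp lam - 1) * W) := by
  have hpi := Real.pi_pos
  have hl : (0 : ℝ) < lam := hlam
  rw [linearWeight, norm_mul, norm_mul, norm_exp_neg_I_mul, one_mul, Complex.norm_real,
    Real.norm_of_nonneg (by positivity)]
  gcongr
  exact norm_stochCoeff_le hf hlam hWb h t

lemma continuous_stochCoeff (hf : IsDensity f) (hW : Continuous (cf w)) (h : ℝ) :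
    Continuous (stochCoeff lam f w h) := by
  have := continuous_cf hf.integrable
  unfold stochCoeff
  fun_prop

lemma continuous_linearWeight (hf : IsDensity f) (hW : Continuous (cf w)) (h x : ℝ) :
    Continuous (linearWeight lam f w h x) := by
  have := continuous_stochCoeff (lam := lam) hf hW h
  unfold linearWeight
  fun_prop

/-- The tail of the inversion integral beyond `1 / h` is at most the `β`-th moment of `‖cf f‖` times
`h ^ β`. -/
lemma norm_inversion_tail_le (hβ : 0 < β) (hF : ConditionF β L₁ L₂ f) {h : ℝ} (hh : 0 < h)
    (x : ℝ) : ‖(∫ t : ℝ, Complex.exp (-(Complex.I * (t : ℂ) * (x : ℂ))) * cf f t)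
        - ∫ t in (-(1 / h))..(1 / h), Complex.exp (-(Complex.I * (t : ℂ) * (x : ℂ))) * cf f t‖
      ≤ h ^ β * ∫ t, |t| ^ β * ‖cf f t‖ := by
  have hT0 : 0 < 1 / h := by positivity
  have hT : -(1 / h) ≤ 1 / h := by linarith
  have hint : Integrable fun t : ℝ => Complex.exp (-(Complex.I * (t : ℂ) * (x : ℂ))) * cf f t :=
    (hF.integrable_cf_self hβ).bdd_mul (c := 1) (Continuous.aestronglyMeasurable (by fun_prop))
      (ae_of_all _ fun t => (norm_exp_neg_I_mul t x).le)
  have hJ := hF.integrable_rpow_mul_norm_cf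
  rw [intervalIntegral.integral_of_le hT, ← integral_add_compl measurableSet_Ioc hint,
    add_sub_cancel_left, ← integral_const_mul]
  refine (norm_integral_le_integral_norm _).trans ?_
  refine (setIntegral_mono_on hint.norm.integrableOn (hJ.const_mul _).integrableOn
    measurableSet_Ioc.compl fun t ht => ?_).trans
    (setIntegral_le_integral (hJ.const_mul _) (ae_of_all _ fun t => ?_))
  · rw [norm_mul, norm_exp_neg_I_mul, one_mul, ← mul_assoc,
      ← Real.mul_rpow hh.le (abs_nonneg _)]
    have h1 : 1 ≤ h * |t| := by
      by_contra hcon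
      push Not at hcon
      apply ht
      have h2 : |t| < 1 / h := by rw [lt_div_iff₀ hh]; linarith
      exact ⟨(abs_lt.1 h2).1, (abs_lt.1 h2).2.le⟩
    exact le_mul_of_one_le_left (norm_nonneg _) (Real.one_le_rpow h1 hβ.le)
  · have : (0 : ℝ) ≤ h ^ β := by positivity
    change 0 ≤ h ^ β * (|t| ^ β * ‖cf f t‖)
    positivity

lemma continuous_charFun_nonzeroLaw (hf : IsDensity f) (hlam : 0 < lam) :
    Continuous (charFun (nonzeroLaw lam f)) := by
  have hne : ((Real.exp lam - 1 : ℝ) : ℂ) ≠ 0 := by exact_mod_cast (exp_sub_one_pos hlam).ne'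
  have h1 : charFun (nonzeroLaw lam f)
      = fun t => (Complex.exp (lam * cf f t) - 1) / ((Real.exp lam - 1 : ℝ) : ℂ) := by
    funext t
    rw [← hf.charFun_nonzeroLaw hlam, mul_div_cancel_left₀ _ hne]
  have := continuous_cf hf.integrable
  rw [h1]
  fun_prop

/-- The expansion of the estimator around `f x`: a centred linear term, a bias of order `h ^ β`, and
a remainder controlled by the squared distance of the characteristic functions. -/
lemma exists_expansion (hβ : 0 < β) (hF : ConditionF β L₁ L₂ f) (hW : ConditionW β w)
    (hlam : 0 < lam) {Ω : Type*} (Z : ℕ → Ω → ℝ) :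
    ∃ C : ℝ, 0 < C ∧ ∀ (ω : Ω) (x h : ℝ), 0 < h → ∀ n : ℕ, n ≠ 0 →
      (∀ t : ℝ, ‖path lam w h n (fun k => Z k ω) t / Complex.exp (lam * cf f t) - 1‖ ≤ 1 / 2) →
      |rawEstimator lam w h n (fun k => Z k ω) x
        - (f x + linearTerm (linearWeight lam f w h x) (1 / h) n (nonzeroLaw lam f) Z ω)|
        ≤ C * (h ^ β + quadTerm (1 / h) n (nonzeroLaw lam f) Z ω) := by
  have hf := hF.density
  obtain ⟨W, hW0, hWb⟩ := hW.exists_norm_cf_le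
  obtain ⟨K, hK0, hK⟩ := hW.exists_norm_cf_sub_one_le hβ
  have hpos := exp_sub_one_pos hlam
  have hl : (0 : ℝ) < lam := hlam
  have hpi := Real.pi_pos
  have hcw : Continuous (cf w) := hW.cf_contDiff.continuous
  have hcf := continuous_cf hf.integrable
  have hcg := continuous_charFun_nonzeroLaw hf hlam
  set J := ∫ t, |t| ^ β * ‖cf f t‖ with hJ
  have hJ0 : 0 ≤ J := integral_nonneg fun t => by positivity
  have hJi := hF.integrable_rpow_mul_norm_cf
  set S := Real.exp lam * (Real.exp lam - 1) * W with hS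
  set D := lam * Real.exp lam with hD
  set c := 1 / (2 * Real.pi * (lam : ℝ)) with hc
  have hc0 : 0 < c := by positivity
  set B := (2 * (D * (W + 1)) + 1) * (D * K) with hB
  have hB0 : 0 ≤ B := by positivity
  refine ⟨1 / (2 * Real.pi) * J + c * (B * J) + c * (2 * S ^ 2) + 1, by positivity,
    fun ω x h hh n hn hq => ?_⟩
  set z : ℕ → ℝ := fun k => Z k ω with hz
  set T := 1 / h with hT
  have hT0 : 0 < T := by positivity
  set q : ℝ → ℂ := fun t => path lam w h n z t / Complex.exp (lam * cf f t) - 1 with hqd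
  have hqe : ∀ t, q t = stochCoeff lam f w h t * (empCf n z t - charFun (nonzeroLaw lam f) t)
      + detError lam f w h t := fun t => path_div_exp_sub_one hf hlam w h n z t
  have hcp : Continuous (path lam w h n z) :=
    continuous_path_comp lam hcw h n continuous_const continuous_id
  have hce : Continuous (empCf n z) := continuous_empCf_right n z
  have hcq : Continuous q := (hcp.div (by fun_prop) fun t => Complex.exp_ne_zero _).sub
    continuous_const
  have hclog : Continuous fun t => Complex.log (1 + q t) := by
    refine Continuous.clog (by fun_prop) fun t => ?_
    exact Complex.mem_slitPlane_of_norm_lt_one ((hq t).trans_lt (by norm_num))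
  set E : ℝ → ℂ := fun t => Complex.exp (-(Complex.I * (t : ℂ) * (x : ℂ))) with hE
  have hcE : Continuous E := by simp only [hE]; fun_prop
  have hcs := continuous_stochCoeff (lam := lam) hf hcw h
  set Δ : ℝ → ℂ := fun t => empCf n z t - charFun (nonzeroLaw lam f) t with hΔ
  have hcΔ : Continuous Δ := hce.sub hcg
  -- The distinguished logarithm, computed from the logarithm `lam * cf f` of the limit path.
  have hlog : distLog (path lam w h n z) = fun t => lam * cf f t + Complex.log (1 + q t) := by
    have hf0 : cf f 0 = 1 := cf_zero f hf.integral_eq_one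
    have hp0 := path_zero lam hW.integral_eq_one h hn z
    have h1 := distLog_eq_add_log (L := fun t => lam * cf f t) hcp (by fun_prop)
      (by rw [hp0, hf0, mul_one, ← Complex.ofReal_exp,
        ← Complex.ofReal_log (Real.exp_pos _).le, Real.log_exp])
      (by rw [hp0, hf0, mul_one]) (fun t => (hq t).trans_lt (by norm_num))
    rw [h1]
    funext t
    simp only [hqd, add_sub_cancel]
  have hne : ∀ t, path lam w h n z t ≠ 0 := by
    intro t h0
    have h1 := hq t
    rw [h0, zero_div, zero_sub, norm_neg, norm_one] at h1
    norm_num at h1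
  have hraw : rawEstimator lam w h n z x
      = 1 / (2 * Real.pi) * (∫ t in (-T)..T, E t * cf f t).re
        + c * (∫ t in (-T)..T, E t * Complex.log (1 + q t)).re := by
    rw [rawEstimator, if_pos hne, hlog]
    simp only [mul_add]
    rw [intervalIntegral.integral_add
      (Continuous.intervalIntegrable (by fun_prop) _ _)
      (Continuous.intervalIntegrable (by fun_prop) _ _), Complex.add_re, mul_add]
    congr 1
    have h1 : ∫ t in (-T)..T, E t * (lam * cf f t) = (lam : ℝ) * ∫ t in (-T)..T, E t * cf f t := by
      rw [← intervalIntegral.integral_const_mul]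
      refine intervalIntegral.integral_congr fun t _ => ?_
      ring
    rw [h1, Complex.re_ofReal_mul, ← mul_assoc]
    congr 1
    field_simp
  have hfx : f x = 1 / (2 * Real.pi) * (∫ t, E t * cf f t).re := by
    have := congrArg Complex.re (hF.inversion hβ x)
    rwa [Complex.ofReal_re, Complex.re_ofReal_mul] at this
  have hlin : linearTerm (linearWeight lam f w h x) T n (nonzeroLaw lam f) Z ω
      = c * (∫ t in (-T)..T, E t * (stochCoeff lam f w h t * Δ t)).re := by
    rw [linearTerm, ← Complex.re_ofReal_mul, ← intervalIntegral.integral_const_mul]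
    congr 1
    refine intervalIntegral.integral_congr fun t _ => ?_
    simp only [linearWeight, hΔ, hE, hc, hz]
    ring
  have htail : |(∫ t in (-T)..T, E t * cf f t).re - (∫ t, E t * cf f t).re| ≤ h ^ β * J := by
    rw [← Complex.sub_re, ← abs_neg, ← Complex.neg_re, neg_sub]
    exact (Complex.abs_re_le_norm _).trans (norm_inversion_tail_le hβ hF hh x)
  have hdet : ∀ t, ‖detError lam f w h t‖ ≤ D * K * (h ^ β * (|t| ^ β * ‖cf f t‖)) := by
    intro t
    refine (norm_detError_le hf h t).trans ?_
    calc D * ‖cf f t‖ * ‖cf w (h * t) - 1‖ ≤ D * ‖cf f t‖ * (K * |h * t| ^ β) := by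
          gcongr
          exact hK _
      _ = D * K * (h ^ β * (|t| ^ β * ‖cf f t‖)) := by
          rw [abs_mul, abs_of_pos hh, Real.mul_rpow hh.le (abs_nonneg _)]; ring
  have hdet2 : ∀ t, ‖detError lam f w h t‖ ≤ D * (W + 1) := by
    intro t
    refine (norm_detError_le hf h t).trans ?_
    have h3 : ‖cf w (h * t) - 1‖ ≤ W + 1 :=
      (norm_sub_le _ _).trans (by rw [norm_one]; linarith [hWb (h * t)])
    calc D * ‖cf f t‖ * ‖cf w (h * t) - 1‖ ≤ D * 1 * (W + 1) := by
          gcongr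
          exact hf.norm_cf_le_one t
      _ = D * (W + 1) := by rw [mul_one]
  have hpt : ∀ t, ‖Complex.log (1 + q t) - stochCoeff lam f w h t * Δ t‖
      ≤ 2 * S ^ 2 * ‖Δ t‖ ^ 2 + B * h ^ β * (|t| ^ β * ‖cf f t‖) := by
    intro t
    have h1 := norm_log_one_add_sub_le (hq t)
    have h2 : Complex.log (1 + q t) - stochCoeff lam f w h t * Δ t
        = (Complex.log (1 + q t) - q t) + detError lam f w h t := by
      rw [hqe t]; ring
    have h3 : ‖q t‖ ≤ S * ‖Δ t‖ + ‖detError lam f w h t‖ := by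
      rw [hqe t]
      refine (norm_add_le _ _).trans ?_
      rw [norm_mul]
      gcongr
      exact norm_stochCoeff_le hf hlam hWb h t
    have h4 : ‖q t‖ ^ 2 ≤ 2 * S ^ 2 * ‖Δ t‖ ^ 2 + 2 * ‖detError lam f w h t‖ ^ 2 := by
      have h5 := pow_le_pow_left₀ (norm_nonneg _) h3 2
      nlinarith [sq_nonneg (S * ‖Δ t‖ - ‖detError lam f w h t‖)]
    have h6 : ‖detError lam f w h t‖ ^ 2 ≤ D * (W + 1) * ‖detError lam f w h t‖ := by
      rw [sq]
      exact mul_le_mul_of_nonneg_right (hdet2 t) (norm_nonneg _)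
    have h7 : (2 * (D * (W + 1)) + 1) * ‖detError lam f w h t‖
        ≤ B * h ^ β * (|t| ^ β * ‖cf f t‖) := by
      calc (2 * (D * (W + 1)) + 1) * ‖detError lam f w h t‖
          ≤ (2 * (D * (W + 1)) + 1) * (D * K * (h ^ β * (|t| ^ β * ‖cf f t‖))) := by
            gcongr
            exact hdet t
        _ = B * h ^ β * (|t| ^ β * ‖cf f t‖) := by rw [hB]; ring
    rw [h2]
    refine (norm_add_le _ _).trans ?_
    linarith
  have hrem : ‖(∫ t in (-T)..T, E t * Complex.log (1 + q t))
      - ∫ t in (-T)..T, E t * (stochCoeff lam f w h t * Δ t)‖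
      ≤ 2 * S ^ 2 * quadTerm T n (nonzeroLaw lam f) Z ω + B * h ^ β * J := by
    rw [← intervalIntegral.integral_sub (Continuous.intervalIntegrable (by fun_prop) _ _)
      (Continuous.intervalIntegrable (by fun_prop) _ _)]
    have hi1 : IntervalIntegrable (fun t => 2 * S ^ 2 * ‖Δ t‖ ^ 2) volume (-T) T :=
      Continuous.intervalIntegrable (by fun_prop) _ _
    have hi2 : IntervalIntegrable (fun t : ℝ => B * h ^ β * (|t| ^ β * ‖cf f t‖)) volume (-T) T :=
      (hJi.const_mul _).intervalIntegrable
    refine (intervalIntegral.norm_integral_le_of_norm_le (by linarith)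
      (ae_of_all _ fun t _ => ?_) (hi1.add hi2)).trans ?_
    · rw [← mul_sub, norm_mul, norm_exp_neg_I_mul, one_mul]
      exact hpt t
    · rw [intervalIntegral.integral_add hi1 hi2, intervalIntegral.integral_const_mul,
        intervalIntegral.integral_const_mul]
      refine add_le_add le_rfl (mul_le_mul_of_nonneg_left ?_ (by positivity))
      rw [intervalIntegral.integral_of_le (by linarith)]
      exact setIntegral_le_integral hJi (ae_of_all _ fun t => by positivity)
  have hQ0 : 0 ≤ quadTerm T n (nonzeroLaw lam f) Z ω :=
    intervalIntegral.integral_nonneg (by linarith) fun t _ => by positivity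
  have hre := (Complex.abs_re_le_norm _).trans hrem
  rw [Complex.sub_re] at hre
  rw [hraw, hlin]
  conv_lhs => rw [hfx]
  set I1 := (∫ t in (-T)..T, E t * cf f t).re
  set I2 := (∫ t, E t * cf f t).re
  set I3 := (∫ t in (-T)..T, E t * Complex.log (1 + q t)).re
  set I4 := (∫ t in (-T)..T, E t * (stochCoeff lam f w h t * Δ t)).re
  set Q := quadTerm T n (nonzeroLaw lam f) Z ω
  have hhβ : 0 ≤ h ^ β := by positivity
  have hpi2 : 0 ≤ 1 / (2 * Real.pi) := by positivity
  calc |1 / (2 * Real.pi) * I1 + c * I3 - (1 / (2 * Real.pi) * I2 + c * I4)|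
      = |1 / (2 * Real.pi) * (I1 - I2) + c * (I3 - I4)| := by congr 1; ring
    _ ≤ 1 / (2 * Real.pi) * |I1 - I2| + c * |I3 - I4| := by
        refine (abs_add_le _ _).trans_eq ?_
        rw [abs_mul, abs_mul, abs_of_nonneg hpi2, abs_of_pos hc0]
    _ ≤ 1 / (2 * Real.pi) * (h ^ β * J) + c * (2 * S ^ 2 * Q + B * h ^ β * J) := by gcongr
    _ = (1 / (2 * Real.pi) * J + c * (B * J)) * h ^ β + c * (2 * S ^ 2) * Q := by ring
    _ ≤ (1 / (2 * Real.pi) * J + c * (B * J) + c * (2 * S ^ 2) + 1) * h ^ β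
        + (1 / (2 * Real.pi) * J + c * (B * J) + c * (2 * S ^ 2) + 1) * Q := by
        have h8 : 0 ≤ c * (2 * S ^ 2) := by positivity
        have h9 : 0 ≤ c * (B * J) := by positivity
        have h10 : 0 ≤ 1 / (2 * Real.pi) * J := by positivity
        exact add_le_add (mul_le_mul_of_nonneg_right (by linarith) hhβ)
          (mul_le_mul_of_nonneg_right (by linarith) hQ0)
    _ = _ := by ring

end Expansion

/-! ### The bias of the truncated estimator -/

/-- Truncating `y + l` at a level that exceeds `|y| + 1` costs at most `l ^ 2`. -/
lemma abs_trunc_sub_le {M y l r e : ℝ} (hM : |y| + 1 ≤ M) (hr : |r - (y + l)| ≤ e) :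
    |max (min M r) (-M) - y - l| ≤ e + l ^ 2 := by
  have h1 := abs_le.1 (le_refl |y|)
  have h2 := abs_le.1 hr
  rw [abs_le]
  rcases max_cases (min M r) (-M) with ⟨h3, h4⟩ | ⟨h3, h4⟩ <;>
    rcases min_cases M r with ⟨h5, h6⟩ | ⟨h5, h6⟩ <;> rw [h3] <;>
    constructor <;> nlinarith [sq_nonneg l, sq_nonneg (l - 1), sq_nonneg (l + 1), abs_nonneg y]

section

variable {Ω : Type*} [MeasurableSpace Ω] {P : Measure Ω} [IsProbabilityMeasure P]

/-- The passage from a pointwise bound on an event `G` to a bound on the mean, for a variable `F`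
approximated there by a centred variable `l`. -/
lemma abs_integral_le_of_approx {F l Q : Ω → ℝ} {G : Set Ω} (hG : MeasurableSet G) {K C a : ℝ}
    (hF : Integrable F P) (hl : Integrable l P) (hl2 : Integrable (fun ω => l ω ^ 2) P)
    (hQ : Integrable Q P) (hQ0 : ∀ ω, 0 ≤ Q ω) (hC : 0 ≤ C) (ha : 0 ≤ a) (hl0 : ∫ ω, l ω ∂P = 0)
    (hon : ∀ ω ∈ G, |F ω - l ω| ≤ C * (a + Q ω) + l ω ^ 2)
    (hoff : ∀ ω, |F ω - l ω| ≤ K) :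
    |∫ ω, F ω ∂P| ≤ C * (a + ∫ ω, Q ω ∂P) + ∫ ω, l ω ^ 2 ∂P + K * P.real Gᶜ := by
  have hind : Integrable (Gᶜ.indicator fun _ => K) P :=
    (integrable_const K).indicator hG.compl
  have h1 : ∫ ω, F ω ∂P = ∫ ω, (F ω - l ω) ∂P := by rw [integral_sub hF hl, hl0, sub_zero]
  have haQ : Integrable (fun ω => C * (a + Q ω)) P := ((integrable_const a).add hQ).const_mul C
  have hb : Integrable (fun ω => C * (a + Q ω) + l ω ^ 2 + Gᶜ.indicator (fun _ => K) ω) P :=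
    (haQ.add hl2).add hind
  rw [h1, ← Real.norm_eq_abs]
  refine (norm_integral_le_of_norm_le hb (ae_of_all _ fun ω => ?_)).trans_eq ?_
  · rw [Real.norm_eq_abs]
    by_cases hω : ω ∈ G
    · rw [Set.indicator_of_notMem (by simpa using hω), add_zero]
      exact hon ω hω
    · rw [Set.indicator_of_mem (by simpa using hω)]
      have h2 : 0 ≤ C * (a + Q ω) := mul_nonneg hC (add_nonneg ha (hQ0 ω))
      linarith [hoff ω, sq_nonneg (l ω)]
  · have e1 : ∫ ω, (C * (a + Q ω) + l ω ^ 2 + Gᶜ.indicator (fun _ => K) ω) ∂P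
        = ∫ ω, (C * (a + Q ω) + l ω ^ 2) ∂P + ∫ ω, Gᶜ.indicator (fun _ => K) ω ∂P :=
      integral_add (haQ.add hl2) hind
    have e2 : ∫ ω, (C * (a + Q ω) + l ω ^ 2) ∂P
        = ∫ ω, C * (a + Q ω) ∂P + ∫ ω, l ω ^ 2 ∂P := integral_add haQ hl2
    rw [e1, e2, integral_const_mul, integral_add (integrable_const a) hQ,
      integral_indicator_const _ hG.compl]
    simp [mul_comm]

/-- The bias bound for fixed `n`: the exponential term accounts for the event on which the
empirical characteristic function is far from its limit. -/
lemma exists_bias_bound {β L₁ L₂ : ℝ} {f w : ℝ → ℝ} {lam : ℝ≥0} (hβ : 0 < β)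
    (hF : ConditionF β L₁ L₂ f) (hW : ConditionW β w) (hlam : 0 < lam) {Z : ℕ → Ω → ℝ}
    (hZ : IsIID P (nonzeroLaw lam f) Z) (x : ℝ) :
    ∃ C c h₀ : ℝ, 0 < C ∧ 0 < c ∧ 0 < h₀ ∧ ∀ (n : ℕ) (h M : ℝ), n ≠ 0 → 0 < h → h < h₀ →
      |f x| + 1 ≤ M →
      |(∫ ω, estimator lam w h M n (fun k => Z k ω) x ∂P) - f x|
        ≤ C * (h ^ β + 1 / (n * h)) + C * (M + 1 / h) * (1 + 1 / h) * Real.exp (-c * n) := by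
  have hf := hF.density
  have := hf.isProbabilityMeasure_nonzeroLaw hlam
  have hpos := exp_sub_one_pos hlam
  have hl : (0 : ℝ) < lam := hlam
  have hpi := Real.pi_pos
  have hcw : Continuous (cf w) := hW.cf_contDiff.continuous
  obtain ⟨W, hW0, hWb⟩ := hW.exists_norm_cf_le
  obtain ⟨ε, h₀, hε, hh₀, hclose⟩ := exists_norm_path_div_exp_sub_one_le hβ hf hW hlam
  obtain ⟨A', c, hA', hc, hdev⟩ := hZ.exists_uniform_deviation hε
  obtain ⟨C₁, hC₁, hexp⟩ := exists_expansion hβ hF hW hlam Z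
  set A := 1 / (2 * Real.pi * lam) * (Real.exp lam * (Real.exp lam - 1) * W) with hA
  have hA0 : 0 < A := by positivity
  set I := ∫ t, ‖charFun (nonzeroLaw lam f) t‖ with hI
  have hI0 : 0 ≤ I := integral_nonneg fun t => norm_nonneg _
  refine ⟨2 * C₁ + 2 * A ^ 2 * I + (2 + 4 * A) * A', c, h₀, by positivity, hc, hh₀,
    fun n h M hn hh hlt hM => ?_⟩
  have hn0 : (0 : ℝ) < n := by exact_mod_cast Nat.pos_of_ne_zero hn
  set T := 1 / h with hT
  have hT0 : 0 < T := by positivity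
  have hM0 : 0 ≤ M := by linarith [abs_nonneg (f x)]
  obtain ⟨G, hG, hGp, hGd⟩ := hdev n hn T hT0.le
  set F : Ω → ℝ := fun ω => estimator lam w h M n (fun k => Z k ω) x - f x with hFd
  have ha := continuous_linearWeight (lam := lam) hf hcw h x
  have hAb := norm_linearWeight_le hf hlam hWb h x
  set l : Ω → ℝ := linearTerm (linearWeight lam f w h x) T n (nonzeroLaw lam f) Z with hld
  have hlm : Measurable l := measurable_linearTerm hZ ha hAb hT0.le n
  have hlb : ∀ ω, |l ω| ≤ A * (4 * T) := fun ω => abs_linearTerm_le hAb hT0.le hn ω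
  have hli : Integrable l P := integrable_of_bounded hlm.aestronglyMeasurable hlb
  have hl2 : Integrable (fun ω => l ω ^ 2) P := by
    refine integrable_of_bounded (K := (A * (4 * T)) ^ 2) (hlm.pow_const 2).aestronglyMeasurable
      fun ω => ?_
    rw [Real.norm_of_nonneg (sq_nonneg _), ← sq_abs]
    exact pow_le_pow_left₀ (abs_nonneg _) (hlb ω) 2
  obtain ⟨hQi, hQle⟩ := integrable_quadTerm_and_integral_le hZ hT0.le hn
  have hQ0 : ∀ ω, 0 ≤ quadTerm T n (nonzeroLaw lam f) Z ω := fun ω =>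
    intervalIntegral.integral_nonneg (by linarith) fun t _ => by positivity
  have hem : Measurable fun ω => estimator lam w h M n (fun k => Z k ω) x :=
    (measurable_estimator hW.integral_eq_one hcw hW.cf_support hh M hn x).comp
      (measurable_pi_lambda _ hZ.measurable)
  have heb : ∀ ω, |estimator lam w h M n (fun k => Z k ω) x| ≤ M := fun ω =>
    abs_estimator_le lam w h hM0 n _ x
  have hei : Integrable (fun ω => estimator lam w h M n (fun k => Z k ω) x) P :=
    integrable_of_bounded hem.aestronglyMeasurable heb
  have hFi : Integrable F P := hei.sub (integrable_const _)
  have hFint : (∫ ω, estimator lam w h M n (fun k => Z k ω) x ∂P) - f x = ∫ ω, F ω ∂P := by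
    rw [hFd, integral_sub hei (integrable_const _)]
    simp
  have hmain := abs_integral_le_of_approx (K := 2 * M + A * (4 * T)) (C := C₁) (a := h ^ β) hG
    hFi hli hl2 hQi hQ0 hC₁.le (by positivity) (integral_linearTerm hZ ha hAb hT0.le hn)
    (fun ω hω => abs_trunc_sub_le hM
      (hexp ω x h hh n hn (hclose h hh hlt n _ (hGd ω hω))))
    (fun ω => by
      have h1 := abs_le.1 (heb ω)
      have h2 := abs_le.1 (hlb ω)
      have h3 := abs_le.1 (le_refl |f x|)
      rw [abs_le]; constructor <;> simp only [hFd] <;> linarith)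
  have hl2le : ∫ ω, l ω ^ 2 ∂P ≤ 1 / (n : ℝ) * (A ^ 2 * (2 * T) * I) :=
    integral_linearTerm_sq_le hZ (hF.integrable_charFun_nonzeroLaw hβ hlam) ha hAb hT0.le hn
  have hnT : 1 / (n * h) = T / n := by rw [hT]; field_simp
  rw [hFint, hnT]
  have hKP : (2 * M + A * (4 * T)) * P.real Gᶜ
      ≤ (2 + 4 * A) * A' * (M + T) * (1 + T) * Real.exp (-c * n) := by
    calc (2 * M + A * (4 * T)) * P.real Gᶜ
        ≤ (2 * M + A * (4 * T)) * (A' * (1 + T) * Real.exp (-c * n)) := by gcongr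
      _ ≤ ((2 + 4 * A) * (M + T)) * (A' * (1 + T) * Real.exp (-c * n)) := by
          gcongr
          have : 0 ≤ A * M := by positivity
          nlinarith
      _ = _ := by ring
  have hhβ : 0 ≤ h ^ β := by positivity
  have hTn : 0 ≤ T / n := by positivity
  have hX : 0 ≤ (M + T) * (1 + T) * Real.exp (-c * n) := by positivity
  have hAI : 0 ≤ A ^ 2 * I := by positivity
  have hAA : 0 ≤ (2 + 4 * A) * A' := by positivity
  calc |∫ ω, F ω ∂P| ≤ C₁ * (h ^ β + 2 * T / n) + 1 / (n : ℝ) * (A ^ 2 * (2 * T) * I)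
        + (2 + 4 * A) * A' * (M + T) * (1 + T) * Real.exp (-c * n) := by
        refine hmain.trans (add_le_add (add_le_add ?_ hl2le) hKP)
        gcongr
    _ = C₁ * h ^ β + (2 * C₁ + 2 * A ^ 2 * I) * (T / n)
        + (2 + 4 * A) * A' * ((M + T) * (1 + T) * Real.exp (-c * n)) := by ring
    _ ≤ (2 * C₁ + 2 * A ^ 2 * I + (2 + 4 * A) * A') * h ^ β
        + (2 * C₁ + 2 * A ^ 2 * I + (2 + 4 * A) * A') * (T / n)
        + (2 * C₁ + 2 * A ^ 2 * I + (2 + 4 * A) * A')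
          * ((M + T) * (1 + T) * Real.exp (-c * n)) :=
        add_le_add (add_le_add (mul_le_mul_of_nonneg_right (by linarith) hhβ)
          (mul_le_mul_of_nonneg_right (by linarith) hTn))
          (mul_le_mul_of_nonneg_right (by linarith) hX)
    _ = _ := by ring

end

/-- The exponentially small term is absorbed by `1 / (n * h)`, because `M` and `1 / h` grow at most
polynomially. -/
lemma eventually_exp_term_le {h M : ℕ → ℝ} (hH : ConditionH h) (hM : ConditionM M) {c : ℝ}
    (hc : 0 < c) : ∃ K : ℝ, 0 < K ∧ ∀ᶠ n : ℕ in atTop,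
      (M n + 1 / h n) * (1 + 1 / h n) * Real.exp (-c * n) ≤ K * (1 / (n * h n)) := by
  obtain ⟨C, γ, hC, hγ, hγ1, hh⟩ := hH
  obtain ⟨α, hα, hMn⟩ := hM
  refine ⟨(1 + 1 / C) * (C + 1), by positivity, ?_⟩
  have hlim := (tendsto_rpow_mul_exp_neg_mul_atTop_nhds_zero (α + 2) c hc).comp
    (tendsto_natCast_atTop_atTop (R := ℝ))
  filter_upwards [hlim.eventually_le_const (show (0 : ℝ) < 1 by norm_num), eventually_ge_atTop 1]
    with n hn hn1
  have hn1' : (1 : ℝ) ≤ n := by exact_mod_cast hn1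
  have hn0 : (0 : ℝ) < n := by linarith
  simp only [Function.comp] at hn
  have hhn : h n = C * (n : ℝ) ^ (-γ) := hh n hn1
  have hhpos : 0 < h n := by rw [hhn]; positivity
  have hhle : h n ≤ C := by
    rw [hhn]
    exact mul_le_of_le_one_right hC.le (Real.rpow_le_one_of_one_le_of_nonpos hn1' (by linarith))
  have h1 : 1 / h n = (1 / C) * (n : ℝ) ^ γ := by
    rw [hhn, Real.rpow_neg hn0.le]; field_simp
  have h2 : (n : ℝ) ^ γ ≤ (n : ℝ) ^ (α + 1) :=
    Real.rpow_le_rpow_of_exponent_le hn1' (by linarith)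
  have h3 : M n ≤ (n : ℝ) ^ (α + 1) := by
    rw [hMn n hn1]; exact Real.rpow_le_rpow_of_exponent_le hn1' (by linarith)
  have hp : (0 : ℝ) ≤ (n : ℝ) ^ (α + 1) := by positivity
  have h4 : M n + 1 / h n ≤ (1 + 1 / C) * (n : ℝ) ^ (α + 1) := by
    rw [h1, add_mul, one_mul]
    gcongr
  have h5 : (n : ℝ) ^ (α + 2) = n * (n : ℝ) ^ (α + 1) := by
    rw [show α + 2 = (α + 1) + 1 by ring, Real.rpow_add_one hn0.ne', mul_comm]
  rw [h5] at hn
  rw [mul_one_div, le_div_iff₀ (by positivity)]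
  calc (M n + 1 / h n) * (1 + 1 / h n) * Real.exp (-c * n) * (n * h n)
      = (M n + 1 / h n) * (h n + 1) * (n * Real.exp (-c * n)) := by field_simp
    _ ≤ ((1 + 1 / C) * (n : ℝ) ^ (α + 1)) * (C + 1) * (n * Real.exp (-c * n)) := by gcongr
    _ = (1 + 1 / C) * (C + 1) * (n * (n : ℝ) ^ (α + 1) * Real.exp (-c * n)) := by ring
    _ ≤ (1 + 1 / C) * (C + 1) * 1 := by gcongr
    _ = (1 + 1 / C) * (C + 1) := mul_one _

lemma ConditionH.pos {h : ℕ → ℝ} (hH : ConditionH h) {n : ℕ} (hn : 1 ≤ n) : 0 < h n := by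
  obtain ⟨C, γ, hC, -, -, hh⟩ := hH
  have : (0 : ℝ) < n := by exact_mod_cast hn
  rw [hh n hn]; positivity

lemma ConditionH.tendsto {h : ℕ → ℝ} (hH : ConditionH h) : Tendsto h atTop (𝓝 0) := by
  obtain ⟨C, γ, -, hγ, -, hh⟩ := hH
  have h1 := ((tendsto_rpow_neg_atTop hγ).comp (tendsto_natCast_atTop_atTop (R := ℝ))).const_mul C
  rw [mul_zero] at h1
  refine h1.congr' ?_
  filter_upwards [eventually_ge_atTop 1] with n hn using (hh n hn).symm

lemma ConditionM.tendsto {M : ℕ → ℝ} (hM : ConditionM M) : Tendsto M atTop atTop := by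
  obtain ⟨α, hα, hMn⟩ := hM
  refine ((tendsto_rpow_atTop hα).comp (tendsto_natCast_atTop_atTop (R := ℝ))).congr' ?_
  filter_upwards [eventually_ge_atTop 1] with n hn using (hMn n hn).symm

lemma ConditionM.nonneg {M : ℕ → ℝ} (hM : ConditionM M) {n : ℕ} (hn : 1 ≤ n) : 0 ≤ M n := by
  obtain ⟨α, -, hMn⟩ := hM
  rw [hMn n hn]; positivity

end Decompounding

theorem proposition2p1 {Ω : Type*} [MeasurableSpace Ω] (P : Measure Ω) [IsProbabilityMeasure P]
    (lam : ℝ≥0) (hlam : 0 < lam)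
    (β L₁ L₂ : ℝ) (hβ : 0 < β) (hL₁ : 0 < L₁) (hL₂ : 0 < L₂)
    (f w : ℝ → ℝ) (h M : ℕ → ℝ)
    (hF : Decompounding.ConditionF β L₁ L₂ f)
    (hW : Decompounding.ConditionW β w)
    (hH : Decompounding.ConditionH h)
    (hM : Decompounding.ConditionM M)
    (X : ℕ → Ω → ℝ) (hX : Decompounding.IsSample P lam f X)
    (x : ℝ) :
    (∀ n : ℕ, 1 ≤ n → Integrable (fun ω => Decompounding.estimator lam w (h n) (M n) n
        (fun k => Decompounding.nonzeroObs X k ω) x) P) ∧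
    (fun n : ℕ => (∫ ω, Decompounding.estimator lam w (h n) (M n) n
        (fun k => Decompounding.nonzeroObs X k ω) x ∂P) - f x)
      =O[atTop] (fun n : ℕ => (h n) ^ β + 1 / ((n : ℝ) * h n)) := by
  obtain ⟨hZm, hZi, hZl⟩ := hX.nonzeroObs_iid hF.density hlam
  have hZ : Decompounding.IsIID P (Decompounding.nonzeroLaw lam f)
      (Decompounding.nonzeroObs X) := ⟨hZm, hZi, hZl⟩
  refine ⟨fun n hn => ?_, ?_⟩
  · have hm := (Decompounding.measurable_estimator (lam := lam) hW.integral_eq_one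
      hW.cf_contDiff.continuous hW.cf_support (hH.pos hn) (M n)
      (Nat.one_le_iff_ne_zero.1 hn) x).comp (measurable_pi_lambda _ hZm)
    exact Decompounding.integrable_of_bounded hm.aestronglyMeasurable
      fun ω => Decompounding.abs_estimator_le lam w (h n) (hM.nonneg hn) n _ x
  · obtain ⟨C, c, h₀, hC, hc, hh₀, hbound⟩ :=
      Decompounding.exists_bias_bound hβ hF hW hlam hZ x
    obtain ⟨K, hK, hexp⟩ := Decompounding.eventually_exp_term_le hH hM hc
    refine IsBigO.of_bound (C + C * K) ?_
    filter_upwards [hexp, eventually_ge_atTop 1, hH.tendsto.eventually_lt_const hh₀,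
      hM.tendsto.eventually_ge_atTop (|f x| + 1)] with n hn hn1 hhn hMn
    have hpos := hH.pos hn1
    have hn0 : (0 : ℝ) < n := by exact_mod_cast hn1
    have h1 := hbound n (h n) (M n) (Nat.one_le_iff_ne_zero.1 hn1) hpos hhn hMn
    have h2 : 0 ≤ h n ^ β := by positivity
    have h3 : 0 ≤ 1 / ((n : ℝ) * h n) := by positivity
    rw [Real.norm_eq_abs, Real.norm_of_nonneg (add_nonneg h2 h3)]
    have h4 := mul_le_mul_of_nonneg_left hn hC.le
    have h5 : 0 ≤ C * K * h n ^ β := by positivity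
    calc _ ≤ _ := h1
      _ ≤ C * (h n ^ β + 1 / (n * h n)) + C * (K * (1 / (n * h n))) := by
          linarith
      _ ≤ (C + C * K) * (h n ^ β + 1 / (n * h n)) := by linarith
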